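/- Let $n\ge 1$, let $\Sigma\subset\mathbb R^n$ be the simplex of probability vectors, $T\Sigma=\{v\in\mathbb R^n:\sum_i v_i=0\}$, and $\underline 1=(1,\dots,1)'$. For a real $n\times n$ matrix $M$ put $BR_p(q)=\operatorname{argmax}_{p\in\Sigma}p'Mq$, $BR_q(p)=\operatorname{argmin}_{q\in\Sigma}p'Mq$ (both set-valued), and $$H(p,q)=\max_{x\in\Sigma}x'Mq-\min_{y\in\Sigma}p'My .$$ A pair $(\bar p,\bar q)\in\Sigma\times\Sigma$ is a Nash equilibrium if $\bar p\in BR_p(\bar q)$ and $\bar q\in BR_q(\bar p)$. Let $LI^n$ be the set of real $n\times n$ matrices $M$ for which there is a unique pair $(\bar p,\bar q)\in\Sigma\times\Sigma$ with all components strictly positive and $\bar p'M=\lambda\underline 1'$, $M\bar q=\mu\underline 1$ for some $\lambda,\mu\in\mathbb R$. A solution of a differential inclusion on a compact interval is an absolutely continuous curve that satisfies the inclusion at almost every time. For a matrix $A=(a_{ij})$ let $\omega_A=\sum_{ij}a_{ij}\,dp_i\wedge dq_j$. The Hamiltonian vector field $X_H$ of $H$ with respect to $\omega_A$ is set-valued: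 $X_H(x)$ is the set of $V\in T\Sigma\times T\Sigma$ such that $Y\mapsto\omega_A(V,Y)$ is a subgradient at $x$ of the convex function $H$ along $T\Sigma\times T\Sigma$ (so $\omega_A(V,Y)=dH(Y)$ for all $Y\in T\Sigma\times T\Sigma$ wherever $H$ is differentiable along $T\Sigma\times T\Sigma$). **Theorem.** There is a set $W\subset LI^n$ that is open, dense in $LI^n$, and such that $LI^n\setminus W$ has Lebesgue measure zero, so that for each $M\in W$, with completely mixed equilibrium $e=(\bar p,\bar q)$, the following holds. 1. $e$ is the unique Nash equilibrium of the zero-sum game with matrix $M$. 2. The best response dynamics $$\frac{dp}{dt}\in BR_p(q)-p,\qquad \frac{dq}{dt}\in BR_q(p)-q$$ has a unique (forward) flow $\phi_t$, $t\ge0$, on $\Sigma\times\Sigma$: through each point there is exactly one solution, and it stays in $\Sigma\times\Sigma$. Orbits starting off $e$ do not reach $e$ in finite time, and $(t,x)\mapsto\phi_t(x)$ is continuous on $[0,\infty)\times\big((\Sigma\times\Sigma)\setminus\{e\}\big)$. 3. The form $\omega_M$ (that is, $\omega_A$ with $A=M$) is nondegenerate on $T\Sigma\times T\Sigma$. For each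 sufficiently small $\rho>0$, each half-ray in the affine hull of $\Sigma\times\Sigma$ starting at $e$ meets $H^{-1}(\rho)\subset\Sigma\times\Sigma$ in exactly one point, and the radial projection $\pi:(\Sigma\times\Sigma)\setminus\{e\}\to H^{-1}(\rho)$ so defined is continuous. The inclusion $\dot x\in X_H(x)$, where $X_H$ is the Hamiltonian vector field of $H$ with respect to $\omega_M$, has a unique flow $\psi_s$, $s\in\mathbb R$, on $H^{-1}(\rho)$; this flow is continuous, and $\pi$ maps orbits of $\phi$ to orbits of $\psi$ up to an exponential change of time: for all $x\in(\Sigma\times\Sigma)\setminus\{e\}$ and $t\ge0$, $$\pi(\phi_t(x))=\psi_{s}(\pi(x)),\qquad s=\frac{\rho}{H(x)}\,(e^t-1).$$ -/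

import Mathlib

open Set MeasureTheory
open scoped Matrix

/-- The space `ℝⁿ × ℝⁿ` of pairs `(p, q)`. -/
abbrev PhaseSpace (n : ℕ) : Type := (Fin n → ℝ) × (Fin n → ℝ)

/-- `Σ × Σ`, where `Σ` is the simplex of probability vectors in `ℝⁿ`. -/
def strategyPairs (n : ℕ) : Set (PhaseSpace n) :=
  stdSimplex ℝ (Fin n) ×ˢ stdSimplex ℝ (Fin n)

/-- `TΣ × TΣ`: pairs of vectors each of whose components sum to zero. -/
def tangentPairs (n : ℕ) : Set (PhaseSpace n) :=
  {v | ∑ i, v.1 i = 0 ∧ ∑ j, v.2 j = 0}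

/-- `BR_p(q) = argmax_{p ∈ Σ} p' M q`. -/
def bestResponseP {n : ℕ} (M : Matrix (Fin n) (Fin n) ℝ) (q : Fin n → ℝ) : Set (Fin n → ℝ) :=
  {x | x ∈ stdSimplex ℝ (Fin n) ∧ ∀ y ∈ stdSimplex ℝ (Fin n), y ⬝ᵥ (M *ᵥ q) ≤ x ⬝ᵥ (M *ᵥ q)}

/-- `BR_q(p) = argmin_{q ∈ Σ} p' M q`. -/
def bestResponseQ {n : ℕ} (M : Matrix (Fin n) (Fin n) ℝ) (p : Fin n → ℝ) : Set (Fin n → ℝ) :=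
  {y | y ∈ stdSimplex ℝ (Fin n) ∧ ∀ z ∈ stdSimplex ℝ (Fin n), p ⬝ᵥ (M *ᵥ y) ≤ p ⬝ᵥ (M *ᵥ z)}

/-- `x = (p, q)` is a Nash equilibrium of the zero-sum game of `M`: `p ∈ BR_p(q)`, `q ∈ BR_q(p)`. -/
def IsNashEquilibrium {n : ℕ} (M : Matrix (Fin n) (Fin n) ℝ) (x : PhaseSpace n) : Prop :=
  x.1 ∈ bestResponseP M x.2 ∧ x.2 ∈ bestResponseQ M x.1

/-- `x = (p̄, q̄) ∈ Σ × Σ` has strictly positive components, and `p̄' M = lam 1'`, `M q̄ = mu 1`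
for some real `lam`, `mu`. -/
def IsCompletelyMixed {n : ℕ} (M : Matrix (Fin n) (Fin n) ℝ) (x : PhaseSpace n) : Prop :=
  x ∈ strategyPairs n ∧ (∀ i, 0 < x.1 i) ∧ (∀ j, 0 < x.2 j) ∧
    (∃ lam : ℝ, x.1 ᵥ* M = fun _ => lam) ∧ (∃ mu : ℝ, M *ᵥ x.2 = fun _ => mu)

/-- The set `LIⁿ` of matrices with a (unique) completely mixed Nash equilibrium. -/
def completelyMixedMatrices (n : ℕ) : Set (Matrix (Fin n) (Fin n) ℝ) :=
  {M | ∃! x : PhaseSpace n, IsCompletelyMixed M x}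

/-- `H(p, q) = max_{x ∈ Σ} x' M q - min_{y ∈ Σ} p' M y`, given by the same formula on `ℝⁿ × ℝⁿ`. -/
noncomputable def gameHamiltonian {n : ℕ} (M : Matrix (Fin n) (Fin n) ℝ) (x : PhaseSpace n) : ℝ :=
  sSup ((fun a : Fin n → ℝ => a ⬝ᵥ (M *ᵥ x.2)) '' stdSimplex ℝ (Fin n)) -
    sInf ((fun b : Fin n → ℝ => x.1 ⬝ᵥ (M *ᵥ b)) '' stdSimplex ℝ (Fin n))

/-- The level set `H⁻¹(ρ)` of `H : Σ × Σ → ℝ`. -/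
def hamiltonianLevel {n : ℕ} (M : Matrix (Fin n) (Fin n) ℝ) (ρ : ℝ) : Set (PhaseSpace n) :=
  {x | x ∈ strategyPairs n ∧ gameHamiltonian M x = ρ}

/-- The constant two-form `∑ᵢⱼ aᵢⱼ dpᵢ ∧ dqⱼ`, evaluated at the vectors `V` and `Y`. -/
def twoForm {n : ℕ} (A : Matrix (Fin n) (Fin n) ℝ) (V Y : PhaseSpace n) : ℝ :=
  ∑ i, ∑ j, A i j * (V.1 i * Y.2 j - Y.1 i * V.2 j)

/-- The two-form is nondegenerate on `TΣ × TΣ`, i.e. symplectic on `Σ × Σ`. -/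
def IsSymplecticOnTangent {n : ℕ} (A : Matrix (Fin n) (Fin n) ℝ) : Prop :=
  ∀ V ∈ tangentPairs n, (∀ Y ∈ tangentPairs n, twoForm A V Y = 0) → V = 0

/-- The set-valued Hamiltonian vector field of the convex function `H` for the two-form of `A`:
the `V ∈ TΣ × TΣ` for which `ω(V, ·)`, restricted to `TΣ × TΣ`, is a subgradient of `H` along
`TΣ × TΣ` at `x`. Where `H` is differentiable along `TΣ × TΣ` this says that
`ω(V, Y) = dH(Y)` for all `Y ∈ TΣ × TΣ`. -/
def hamiltonianField {n : ℕ} (A M : Matrix (Fin n) (Fin n) ℝ) (x : PhaseSpace n) :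
    Set (PhaseSpace n) :=
  {V | V ∈ tangentPairs n ∧
    ∀ Y ∈ tangentPairs n, gameHamiltonian M x + twoForm A V Y ≤ gameHamiltonian M (x + Y)}

/-- The right-hand side of the best response dynamics
`dp/dt ∈ BR_p(q) - p`, `dq/dt ∈ BR_q(p) - q`. -/
def bestResponseField {n : ℕ} (M : Matrix (Fin n) (Fin n) ℝ) (x : PhaseSpace n) :
    Set (PhaseSpace n) :=
  {v | v.1 + x.1 ∈ bestResponseP M x.2 ∧ v.2 + x.2 ∈ bestResponseQ M x.1}

/-- `γ` solves the differential inclusion `dx/dt ∈ F(x)` on `[a, b]`: it is absolutely continuous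
there and satisfies the inclusion at almost every time. -/
def IsInclusionSolution {n : ℕ} (F : PhaseSpace n → Set (PhaseSpace n)) (a b : ℝ)
    (γ : ℝ → PhaseSpace n) : Prop :=
  AbsolutelyContinuousOnInterval γ a b ∧
    ∀ᵐ t ∂(volume.restrict (Icc a b)), ∃ v ∈ F (γ t), HasDerivAt γ v t

/-- `φ` is the flow on `K`, over the time set `J` (`[0, ∞)` or `ℝ`), of the differential inclusion
`dx/dt ∈ F(x)`: through each point of `K` there is exactly one solution, it stays in `K`, and `φ`
is the family of these solutions. -/
structure IsInclusionFlow {n : ℕ} (F : PhaseSpace n → Set (PhaseSpace n)) (K : Set (PhaseSpace n))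
    (J : Set ℝ) (φ : ℝ → PhaseSpace n → PhaseSpace n) : Prop where
  mapsTo : ∀ t ∈ J, ∀ x ∈ K, φ t x ∈ K
  map_zero : ∀ x ∈ K, φ 0 x = x
  map_add : ∀ s ∈ J, ∀ t ∈ J, ∀ x ∈ K, φ (s + t) x = φ s (φ t x)
  solution : ∀ x ∈ K, ∀ a ∈ J, ∀ b ∈ J, a ≤ b → IsInclusionSolution F a b (fun t => φ t x)
  unique : ∀ x ∈ K, ∀ a ∈ J, ∀ b ∈ J, a ≤ 0 → 0 ≤ b → ∀ γ : ℝ → PhaseSpace n,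
    IsInclusionSolution F a b γ → γ 0 = x → ∀ t ∈ Icc a b, γ t = φ t x

/-- The half-ray from `c` in the direction `v`. -/
def halfRay {n : ℕ} (c v : PhaseSpace n) : Set (PhaseSpace n) :=
  {y | ∃ s : ℝ, 0 ≤ s ∧ y = c + s • v}

/-! Write BR(p, q) for BR_p(q) × BR_q(p). Both dynamics are disguises of one inclusion, Z' ∈ BR(Z)
on ℝⁿ × ℝⁿ. BR is homogeneous of degree zero, so Z = eᵗ x with the clock τ = eᵗ - 1 turns the best
response dynamics into it. BR is also invariant under adding multiples of e, and X_H = BR - e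
(`mem_hamiltonianField_iff`), so Z = y + s e does the same for the Hamiltonian inclusion. If Φ is
the flow of Z' ∈ BR(Z), then φ_t(x) = e⁻ᵗ Φ_{eᵗ-1}(x) and ψ_s(y) = Φ_s(y) - s e. The relation
between them under π is the equivariance of Φ under scaling of space and time and under translation
along e.

It remains to construct Φ. H is constant along solutions, because a velocity v changes its two terms
at the opposite rates v₁'Mv₂ and -v₁'Mv₂. Near z all best responses lie in the face BR(z), so mean
velocities over short times lie there too, and constancy of H forces them to be saddle points of the
payoff on that face (`isSaddle_of_gameHamiltonian_eq`). Conversely, a saddle direction stays a best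
response for a while (`IsSaddle.exists_pos`), and saddles exist by Sion's theorem. If each face has
only one saddle, every solution leaves each point along a prescribed segment. Continuation then
gives existence and uniqueness, compactness gives continuity, and replacing M, Z(t) by -M, -Z(-t)
gives negative times.

Saddles are unique when certain minors of the bordered matrix do not vanish: a count of supports
against equalized rows excludes a second saddle (`SupportBound.eq_of_equalizes`). None of these
minors vanishes identically, so the exceptional matrices form a closed null set.
`completelyMixedMatrices` is open by Cramer's rule, and W is its intersection with the generic
matrices.

Finally, H(e + v) = H(v) is positively homogeneous and positive for tangent v ≠ 0. This gives the
radial projection, and H(φ_t(x)) = e⁻ᵗ H(x) keeps orbits off e. -/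

/-! ### Minors of the bordered matrix and genericity -/

/-- The matrix `M` bordered by a row and a column of ones, with a zero in the corner. -/
def bordered {ι κ : Type*} (M : Matrix ι κ ℝ) : Matrix (Option ι) (Option κ) ℝ
  | some i, some j => M i j
  | none, none => 0
  | _, _ => 1

theorem bordered_transpose {ι κ : Type*} (M : Matrix ι κ ℝ) : bordered Mᵀ = (bordered M)ᵀ := by
  ext i j
  cases i <;> cases j <;> rfl

theorem continuous_bordered {ι κ : Type*} :
    Continuous (bordered : Matrix ι κ ℝ → Matrix (Option ι) (Option κ) ℝ) := by
  refine continuous_matrix fun i j => ?_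
  cases i <;> cases j <;> simp only [bordered] <;> fun_prop

/-- A minor of the bordered matrix that does not vanish at one matrix `D` vanishes only at
finitely many points of each line with direction `D`. -/
theorem finite_setOf_det_bordered_add_smul_eq_zero {ι m : Type*} [Fintype ι] [DecidableEq ι]
    (f g : ι → Option m) {D : Matrix m m ℝ} (hD : ((bordered D).submatrix f g).det ≠ 0)
    (M : Matrix m m ℝ) : {t : ℝ | ((bordered (M + t • D)).submatrix f g).det = 0}.Finite := by
  -- Subtracting `bordered 0` removes the border, so only the inner block of the pencil depends on
  -- the variable and `p` evaluates to the minor of `r • M + D`.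
  set A : Matrix ι ι ℝ := ((bordered M - bordered 0).submatrix f g) with hA
  set p : Polynomial ℝ := ((Polynomial.X : Polynomial ℝ) • A.map Polynomial.C +
    ((bordered D).submatrix f g).map Polynomial.C).det with hp
  have hp0 : p ≠ 0 := by
    intro h
    apply hD
    rw [← Polynomial.coeff_det_X_add_C_zero A, ← hp, h, Polynomial.coeff_zero]
  have heval : ∀ r : ℝ, p.eval r = ((bordered (r • M + D)).submatrix f g).det := by
    intro r
    rw [hp, ← Polynomial.coe_evalRingHom, RingHom.map_det]
    congr 1
    ext i j
    simp only [hA, RingHom.mapMatrix_apply, Matrix.map_apply, Matrix.add_apply, Matrix.smul_apply,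
      Matrix.submatrix_apply, Matrix.sub_apply]
    cases f i <;> cases g j <;> simp [bordered, mul_comm r]
  have hscale : ∀ t : ℝ, t ≠ 0 → ((bordered (M + t • D)).submatrix f g).det = 0 →
      p.eval t⁻¹ = 0 := by
    intro t ht h
    -- Scaling the inner rows by `t` and the border column by `t⁻¹` preserves the border of ones and
    -- turns `t⁻¹ • M + D` into `M + t • D`.
    let a : Option m → ℝ := fun i => i.elim 1 fun _ => t
    let b : Option m → ℝ := fun i => i.elim t⁻¹ fun _ => 1
    have key : (bordered (M + t • D)).submatrix f g =
        Matrix.diagonal (a ∘ f) * (bordered (t⁻¹ • M + D)).submatrix f g *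
          Matrix.diagonal (b ∘ g) := by
      ext i j
      rw [Matrix.mul_diagonal, Matrix.diagonal_mul]
      simp only [Matrix.submatrix_apply, Function.comp, a, b]
      cases f i <;> cases g j <;> simp [bordered, ht, mul_add]
    rw [key, Matrix.det_mul, Matrix.det_mul, Matrix.det_diagonal, Matrix.det_diagonal] at h
    rw [heval]
    have h1 : ∏ i, (a ∘ f) i ≠ 0 := Finset.prod_ne_zero_iff.2 fun i _ => by
      simp only [Function.comp, a]; cases f i <;> simp [ht]
    have h2 : ∏ i, (b ∘ g) i ≠ 0 := Finset.prod_ne_zero_iff.2 fun i _ => by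
      simp only [Function.comp, b]; cases g i <;> simp [ht]
    exact (mul_eq_zero.1 ((mul_eq_zero.1 h).resolve_right h2)).resolve_left h1
  have hroots : ((fun r : ℝ => r⁻¹) ⁻¹' {r | p.IsRoot r}).Finite :=
    (Polynomial.finite_setOfPred_isRoot hp0).preimage inv_injective.injOn
  refine (hroots.union (finite_singleton 0)).subset fun t ht => ?_
  by_cases h0 : t = 0
  · exact Or.inr h0
  · exact Or.inl (hscale t h0 ht)

/-- Fubini in the direction `D`: every line parallel to `D` meets the zero set in finitely many
points. -/
theorem ae_det_bordered_submatrix_ne_zero {n : ℕ} {ι : Type*} [Fintype ι] [DecidableEq ι]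
    (f g : ι → Option (Fin n)) {D : Matrix (Fin n) (Fin n) ℝ}
    (hD : ((bordered D).submatrix f g).det ≠ 0) :
    ∀ᵐ B : Fin n → Fin n → ℝ, ((bordered (Matrix.of B)).submatrix f g).det ≠ 0 := by
  have hc : Continuous fun B : Fin n → Fin n → ℝ =>
      ((bordered (Matrix.of B)).submatrix f g).det :=
    ((continuous_bordered (ι := Fin n) (κ := Fin n)).matrix_submatrix f g).matrix_det
  refine MeasureTheory.ae_mem_of_ae_add_linearMap_mem
    (LinearMap.toSpanSingleton ℝ (Fin n → Fin n → ℝ) D) volume volume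
    (s := {B | ((bordered (Matrix.of B)).submatrix f g).det ≠ 0})
    (isOpen_ne_fun hc continuous_const).measurableSet fun B => ?_
  have := (finite_setOf_det_bordered_add_smul_eq_zero f g hD (Matrix.of B)).measure_zero volume
  rw [ae_iff]
  convert this using 3
  ext t
  simp
  rfl

theorem Matrix.det_ne_zero_of_mulVec_eq_zero {ι : Type*} [Fintype ι] [DecidableEq ι]
    {A : Matrix ι ι ℝ} (h : ∀ c, A *ᵥ c = 0 → c = 0) : A.det ≠ 0 := by
  intro h0
  obtain ⟨c, hc, hc0⟩ := Matrix.exists_mulVec_eq_zero_iff.2 h0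
  exact hc (h c hc0)

/-- For some matrix the minor with the rows `f` and the columns `g`, the border column among them,
does not vanish. -/
theorem exists_det_bordered_submatrix_some_ne_zero {m κ : Type*} [Fintype κ] [DecidableEq κ]
    [DecidableEq m] (f : Option κ ↪ m) (g : κ ↪ m) :
    ∃ D : Matrix m m ℝ, ((bordered D).submatrix (some ∘ f) (Option.map g)).det ≠ 0 := by
  classical
  -- This choice produces the row (1, 0, …, 0) at `f none` and the rows (1, e_a) at `f (some a)`, a
  -- unitriangular matrix.
  refine ⟨fun i j => if ∃ a, f (some a) = i ∧ g a = j then 1 else 0,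
    Matrix.det_ne_zero_of_mulVec_eq_zero fun c hc => ?_⟩
  have h0 : c none = 0 := by
    have := congrFun hc none
    simpa [Matrix.mulVec, dotProduct, Fintype.sum_option, bordered] using this
  ext a
  cases a with
  | none => exact h0
  | some a =>
    have := congrFun hc (some a)
    simp only [Matrix.mulVec, dotProduct, Fintype.sum_option, bordered, Matrix.submatrix_apply,
      Function.comp, Option.map_none, Option.map_some, h0, mul_zero, zero_add,
      EmbeddingLike.apply_eq_iff_eq, Option.some.injEq, exists_eq_left, ite_mul, one_mul,
      zero_mul, Finset.sum_ite_eq, Finset.mem_univ, if_true, Pi.zero_apply] at this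
    exact this

theorem exists_det_bordered_submatrix_map_ne_zero {m κ : Type*} [Fintype κ] [DecidableEq κ]
    [DecidableEq m] [Nonempty κ] (f g : κ ↪ m) :
    ∃ D : Matrix m m ℝ, ((bordered D).submatrix (Option.map f) (Option.map g)).det ≠ 0 := by
  classical
  -- This produces the identity bordered by ones, of determinant -|κ|; hence the need for `κ` to be
  -- nonempty.
  refine ⟨fun i j => if ∃ a, f a = i ∧ g a = j then 1 else 0,
    Matrix.det_ne_zero_of_mulVec_eq_zero fun c hc => ?_⟩
  have h1 : ∀ a, c none + c (some a) = 0 := fun a => by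
    have := congrFun hc (some a)
    simpa [Matrix.mulVec, dotProduct, Fintype.sum_option, bordered] using this
  have h2 : ∑ a, c (some a) = 0 := by
    have := congrFun hc none
    simpa [Matrix.mulVec, dotProduct, Fintype.sum_option, bordered] using this
  have h3 : ∀ a, c (some a) = - c none := fun a => by linarith [h1 a]
  have h0 : c none = 0 := by
    simpa [h3] using h2
  ext a
  cases a with
  | none => exact h0
  | some a => simp [h3, h0]

/-- The minors of the bordered matrix that decide the uniqueness of equilibria do not vanish. -/
def IsGenericMatrix {n : ℕ} (M : Matrix (Fin n) (Fin n) ℝ) : Prop :=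
  (∀ (k : Fin (n + 1)) (f : Option (Fin k) ↪ Fin n) (g : Fin k ↪ Fin n),
    ((bordered M).submatrix (some ∘ f) (Option.map g)).det ≠ 0) ∧
  (∀ (k : Fin (n + 1)) (f : Option (Fin k) ↪ Fin n) (g : Fin k ↪ Fin n),
    ((bordered M).submatrix (Option.map g) (some ∘ f)).det ≠ 0) ∧
  ∀ (k : Fin (n + 1)) (f g : Fin k ↪ Fin n), 0 < (k : ℕ) →
    ((bordered M).submatrix (Option.map f) (Option.map g)).det ≠ 0

theorem IsGenericMatrix.transpose {n : ℕ} {M : Matrix (Fin n) (Fin n) ℝ}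
    (h : IsGenericMatrix M) : IsGenericMatrix Mᵀ := by
  refine ⟨fun k f g => ?_, fun k f g => ?_, fun k f g hk => ?_⟩ <;>
    rw [bordered_transpose, ← Matrix.transpose_submatrix, Matrix.det_transpose]
  exacts [h.2.1 k f g, h.1 k f g, h.2.2 k g f hk]

theorem isOpen_setOf_isGenericMatrix (n : ℕ) :
    IsOpen {M : Matrix (Fin n) (Fin n) ℝ | IsGenericMatrix M} := by
  have key : ∀ {ι : Type} [Fintype ι] [DecidableEq ι] (f g : ι → Option (Fin n)),
      IsOpen {M : Matrix (Fin n) (Fin n) ℝ | ((bordered M).submatrix f g).det ≠ 0} :=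
    fun f g => isOpen_ne_fun (continuous_bordered.matrix_submatrix f g).matrix_det
      continuous_const
  simp only [IsGenericMatrix, ofPred_and, ofPred_forall]
  refine IsOpen.inter ?_ (IsOpen.inter ?_ ?_)
  · exact isOpen_iInter_of_finite fun k => isOpen_iInter_of_finite fun f =>
      isOpen_iInter_of_finite fun g => key _ _
  · exact isOpen_iInter_of_finite fun k => isOpen_iInter_of_finite fun f =>
      isOpen_iInter_of_finite fun g => key _ _
  · exact isOpen_iInter_of_finite fun k => isOpen_iInter_of_finite fun f =>
      isOpen_iInter_of_finite fun g => isOpen_iInter_of_finite fun _ => key _ _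

theorem ae_isGenericMatrix (n : ℕ) :
    ∀ᵐ B : Fin n → Fin n → ℝ, IsGenericMatrix (Matrix.of B) := by
  refine (ae_all_iff.2 fun k => ae_all_iff.2 fun f => ae_all_iff.2 fun g => ?_).and
    ((ae_all_iff.2 fun k => ae_all_iff.2 fun f => ae_all_iff.2 fun g => ?_).and
    (ae_all_iff.2 fun k => ae_all_iff.2 fun f => ae_all_iff.2 fun g => ae_all_iff.2 fun hk => ?_))
  · obtain ⟨D, hD⟩ := exists_det_bordered_submatrix_some_ne_zero f g
    exact ae_det_bordered_submatrix_ne_zero _ _ hD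
  · obtain ⟨D, hD⟩ := exists_det_bordered_submatrix_some_ne_zero f g
    refine ae_det_bordered_submatrix_ne_zero _ _ (D := Dᵀ) ?_
    rwa [bordered_transpose, ← Matrix.transpose_submatrix, Matrix.det_transpose]
  · have : Nonempty (Fin k) := ⟨⟨0, hk⟩⟩
    obtain ⟨D, hD⟩ := exists_det_bordered_submatrix_map_ne_zero f g
    exact ae_det_bordered_submatrix_ne_zero _ _ hD

theorem dense_setOf_isGenericMatrix (n : ℕ) :
    Dense {M : Matrix (Fin n) (Fin n) ℝ | IsGenericMatrix M} :=
  Measure.dense_of_ae (X := Fin n → Fin n → ℝ) (μ := volume) (ae_isGenericMatrix n)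

theorem exists_embedding_sum_eq {n : ℕ} (S : Finset (Fin n)) :
    ∃ g : Fin S.card ↪ Fin n, (∀ b, g b ∈ S) ∧ (∀ j ∈ S, ∃ b, g b = j) ∧
      ∀ F : Fin n → ℝ, (∀ j ∉ S, F j = 0) → ∑ b, F (g b) = ∑ j, F j := by
  refine ⟨S.equivFin.symm.toEmbedding.trans (Function.Embedding.subtype _), fun b => ?_,
    fun j hj => ⟨S.equivFin ⟨j, hj⟩, by simp⟩, fun F hF => ?_⟩
  · exact (S.equivFin.symm b).2
  · have h1 : ∑ b, F (S.equivFin.symm b) = ∑ s : S, F s :=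
      Equiv.sum_comp S.equivFin.symm fun s : S => F s
    have h2 : ∑ s : S, F s = ∑ j ∈ S, F j := Finset.sum_coe_sort S F
    refine Eq.trans (h1.trans h2) (Finset.sum_subset (Finset.subset_univ S) fun j _ hj => hF j hj)

theorem exists_embedding_of_card_le {n : ℕ} {ι : Type*} [Fintype ι] {T : Finset (Fin n)}
    (h : Fintype.card ι ≤ T.card) : ∃ f : ι ↪ Fin n, ∀ a, f a ∈ T := by
  obtain ⟨f⟩ := Function.Embedding.nonempty_of_card_le (α := ι) (β := T) (by simpa using h)
  exact ⟨f.trans (Function.Embedding.subtype _), fun a => (f a).2⟩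

/-- A nonzero vector equalizes at most as many rows of a generic matrix as it has nonzero
entries. -/
theorem IsGenericMatrix.card_le_card_support {n : ℕ} {M : Matrix (Fin n) (Fin n) ℝ}
    (hM : IsGenericMatrix M) {y : Fin n → ℝ} (hy : y ≠ 0) (v : ℝ) :
    (Finset.univ.filter fun i => (M *ᵥ y) i = v).card ≤
      (Finset.univ.filter fun j => y j ≠ 0).card := by
  by_contra! hlt
  set S := Finset.univ.filter fun j => y j ≠ 0 with hS
  obtain ⟨g, -, hgS, hsum⟩ := exists_embedding_sum_eq S
  obtain ⟨f, hf⟩ := exists_embedding_of_card_le (ι := Option (Fin S.card))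
    (T := Finset.univ.filter fun i => (M *ᵥ y) i = v) (by simpa using hlt)
  have hk : S.card < n + 1 := by
    have := Finset.card_le_univ S
    simp only [Fintype.card_fin] at this
    omega
  -- With one more equalized row than support entries, (-v, y on its support) lies in the kernel of
  -- a square submatrix of the bordered matrix.
  refine hM.1 ⟨S.card, hk⟩ f g (Matrix.exists_mulVec_eq_zero_iff.1
    ⟨fun o => o.elim (-v) fun b => y (g b), ?_, ?_⟩)
  · obtain ⟨j, hj⟩ := Function.ne_iff.1 hy
    obtain ⟨b, rfl⟩ := hgS j (by simpa [hS] using hj)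
    exact fun h => hj (congrFun h (some b))
  · ext a
    have h1 : (M *ᵥ y) (f a) = v := by simpa using hf a
    have h2 := hsum (fun j => M (f a) j * y j) fun j hj => by
      have : y j = 0 := by simpa [hS] using hj
      simp [this]
    simp only [Matrix.mulVec, dotProduct] at h1
    simp [Matrix.mulVec, dotProduct, Fintype.sum_option, bordered, h2, h1]

/-- A nonzero vector with sum zero equalizes fewer rows of a generic matrix than it has nonzero
entries. -/
theorem IsGenericMatrix.card_lt_card_support {n : ℕ} {M : Matrix (Fin n) (Fin n) ℝ}
    (hM : IsGenericMatrix M) {d : Fin n → ℝ} (hd : d ≠ 0) (hd0 : ∑ j, d j = 0) (v : ℝ) :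
    (Finset.univ.filter fun i => (M *ᵥ d) i = v).card <
      (Finset.univ.filter fun j => d j ≠ 0).card := by
  by_contra! hle
  set S := Finset.univ.filter fun j => d j ≠ 0 with hS
  obtain ⟨g, -, hgS, hsum⟩ := exists_embedding_sum_eq S
  obtain ⟨f, hf⟩ := exists_embedding_of_card_le (ι := Fin S.card)
    (T := Finset.univ.filter fun i => (M *ᵥ d) i = v) (by simpa using hle)
  have hk : S.card < n + 1 := by
    have := Finset.card_le_univ S
    simp only [Fintype.card_fin] at this
    omega
  obtain ⟨j, hj⟩ := Function.ne_iff.1 hd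
  have hjS : j ∈ S := by simpa [hS] using hj
  have hout : ∀ j ∉ S, d j = 0 := fun j hj => by simpa [hS] using hj
  -- The vanishing sum is the equation of the border row, so one equalized row fewer already gives a
  -- square system.
  refine hM.2.2 ⟨S.card, hk⟩ f g (Finset.card_pos.2 ⟨j, hjS⟩)
    (Matrix.exists_mulVec_eq_zero_iff.1 ⟨fun o => o.elim (-v) fun b => d (g b), ?_, ?_⟩)
  · obtain ⟨b, rfl⟩ := hgS j hjS
    exact fun h => hj (congrFun h (some b))
  · ext a
    cases a with
    | none =>
      have h2 := hsum d hout
      simp [Matrix.mulVec, dotProduct, Fintype.sum_option, bordered, h2, hd0]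
    | some a =>
      have h1 : (M *ᵥ d) (f a) = v := by simpa using hf a
      have h2 := hsum (fun j => M (f a) j * d j) fun j hj => by simp [hout j hj]
      simp only [Matrix.mulVec, dotProduct] at h1
      simp [Matrix.mulVec, dotProduct, Fintype.sum_option, bordered, h2, h1]

/-! ### Openness of the set of matrices with a completely mixed equilibrium -/

/-- `q` is an interior point of the simplex that equalizes the rows of `M`. -/
def IsEqualizer {n : ℕ} (M : Matrix (Fin n) (Fin n) ℝ) (q : Fin n → ℝ) : Prop :=
  q ∈ stdSimplex ℝ (Fin n) ∧ (∀ j, 0 < q j) ∧ ∃ mu : ℝ, M *ᵥ q = fun _ => mu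

section completelyMixed
variable {n : ℕ} {M : Matrix (Fin n) (Fin n) ℝ}

theorem isCompletelyMixed_iff {x : PhaseSpace n} :
    IsCompletelyMixed M x ↔ IsEqualizer Mᵀ x.1 ∧ IsEqualizer M x.2 := by
  simp only [IsCompletelyMixed, IsEqualizer, strategyPairs, mem_prod, Matrix.mulVec_transpose]
  tauto

theorem bordered_mulVec_some (M : Matrix (Fin n) (Fin n) ℝ) (c : Option (Fin n) → ℝ) (i : Fin n) :
    (bordered M *ᵥ c) (some i) = (M *ᵥ fun j => c (some j)) i + c none := by
  simp [Matrix.mulVec, dotProduct, Fintype.sum_option, bordered, add_comm]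

theorem bordered_mulVec_none (M : Matrix (Fin n) (Fin n) ℝ) (c : Option (Fin n) → ℝ) :
    (bordered M *ᵥ c) none = ∑ j, c (some j) := by
  simp [Matrix.mulVec, dotProduct, Fintype.sum_option, bordered]

theorem det_bordered_transpose (M : Matrix (Fin n) (Fin n) ℝ) :
    (bordered Mᵀ).det = (bordered M).det := by
  rw [bordered_transpose, Matrix.det_transpose]

theorem eq_zero_of_mulVec_eq_const (hM : (bordered M).det ≠ 0) {d : Fin n → ℝ}
    (hd : ∑ j, d j = 0) {c : ℝ} (h : M *ᵥ d = fun _ => c) : d = 0 := by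
  by_contra hne
  refine hM (Matrix.exists_mulVec_eq_zero_iff.1 ⟨fun o => o.elim (-c) d, ?_, ?_⟩)
  · exact fun h0 => hne (funext fun j => congrFun h0 (some j))
  · ext i
    cases i with
    | none => rw [bordered_mulVec_none]; exact hd
    | some i =>
      rw [bordered_mulVec_some]
      change (M *ᵥ d) i + -c = 0
      rw [h, add_neg_cancel]

theorem exists_mulVec_add_const_eq (hM : (bordered M).det ≠ 0) (w : Fin n → ℝ) :
    ∃ (d : Fin n → ℝ) (c : ℝ), ∑ j, d j = 0 ∧ (M *ᵥ d + fun _ => c) = w := by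
  set b : Option (Fin n) → ℝ := fun o => o.elim 0 w
  have h : bordered M *ᵥ ((bordered M)⁻¹ *ᵥ b) = b := by
    rw [Matrix.mulVec_mulVec, Matrix.mul_nonsing_inv _ (isUnit_iff_ne_zero.2 hM),
      Matrix.one_mulVec]
  refine ⟨fun j => ((bordered M)⁻¹ *ᵥ b) (some j), ((bordered M)⁻¹ *ᵥ b) none,
    (bordered_mulVec_none M _).symm.trans (congrFun h none), funext fun i => ?_⟩
  exact (bordered_mulVec_some M _ i).symm.trans (congrFun h (some i))

/-- A kernel vector yields a sum-zero `d` with `M *ᵥ d` constant. Moving the second component of the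
equilibrium slightly along `d` would give another completely mixed one, so `d = 0`, and then the
border entry vanishes as well. -/
theorem det_bordered_ne_zero_of_existsUnique [NeZero n] (h : M ∈ completelyMixedMatrices n) :
    (bordered M).det ≠ 0 := by
  obtain ⟨x, hx, huniq⟩ := h
  rw [isCompletelyMixed_iff] at hx
  obtain ⟨hx1, hx2, hpos, mu, hmu⟩ := hx
  refine Matrix.det_ne_zero_of_mulVec_eq_zero fun c hc => ?_
  set d : Fin n → ℝ := fun j => c (some j) with hd
  have hd0 : ∑ j, d j = 0 := by rw [hd, ← bordered_mulVec_none M, hc]; rfl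
  have hMd : M *ᵥ d = fun _ => -c none := funext fun i => by
    have := congrFun hc (some i)
    rw [bordered_mulVec_some] at this
    exact eq_neg_of_add_eq_zero_left this
  have hev : ∀ᶠ ε : ℝ in nhds 0, ∀ j, 0 < x.2 j + ε * d j := by
    refine Filter.eventually_all.2 fun j => ?_
    have hc : Continuous fun ε : ℝ => x.2 j + ε * d j := by fun_prop
    exact hc.continuousAt.eventually (lt_mem_nhds (by simpa using hpos j))
  obtain ⟨ε, hε, hε0⟩ := ((hev.filter_mono nhdsWithin_le_nhds).and
    (self_mem_nhdsWithin (a := (0 : ℝ)) (s := Ioi 0))).exists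
  have hcm : IsCompletelyMixed M (x.1, x.2 + ε • d) := by
    refine isCompletelyMixed_iff.2 ⟨hx1, ⟨fun j => (hε j).le, ?_⟩, hε, mu + ε * -c none, ?_⟩
    · simp [Finset.sum_add_distrib, ← Finset.mul_sum, hx2.2, hd0]
    · rw [Matrix.mulVec_add, Matrix.mulVec_smul, hmu, hMd]
      rfl
  have heq : x.2 + ε • d = x.2 := congrArg Prod.snd (huniq _ hcm)
  have hdz : d = 0 := by
    have : ε • d = 0 := by simpa using heq
    exact (smul_eq_zero.1 this).resolve_left (ne_of_gt hε0)
  ext o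
  cases o with
  | none =>
    have := congrFun hMd 0
    simp only [hdz, Matrix.mulVec_zero, Pi.zero_apply] at this
    simpa using this.symm
  | some j => exact congrFun hdz j

/-- Cramer's rule: (-mu, q) solves the bordered system whose right-hand side is the unit vector of
the border. -/
theorem IsEqualizer.adjugate_eq {q : Fin n → ℝ} (hq : IsEqualizer M q) (j : Fin n) :
    (bordered M).adjugate (some j) none = (bordered M).det * q j := by
  obtain ⟨hq1, -, mu, hmu⟩ := hq
  have h : bordered M *ᵥ (fun o : Option (Fin n) => o.elim (-mu) q) = Pi.single none 1 := by
    ext i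
    cases i with
    | none =>
      rw [bordered_mulVec_none]
      simpa using hq1.2
    | some i =>
      rw [bordered_mulVec_some]
      change (M *ᵥ q) i + -mu = _
      simp [hmu]
  have h2 := congrArg (fun w => ((bordered M).adjugate *ᵥ w) (some j)) h
  simp only [Matrix.mulVec_mulVec, Matrix.adjugate_mul, Matrix.smul_mulVec, Matrix.one_mulVec] at h2
  simpa using h2.symm

theorem IsEqualizer.unique (hM : (bordered M).det ≠ 0) {q q' : Fin n → ℝ} (hq : IsEqualizer M q)
    (hq' : IsEqualizer M q') : q = q' :=
  funext fun j => mul_left_cancel₀ hM ((hq.adjugate_eq j).symm.trans (hq'.adjugate_eq j))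

theorem exists_isEqualizer (hdet : (bordered M).det ≠ 0)
    (hM : ∀ j, 0 < (bordered M).det * (bordered M).adjugate (some j) none) :
    ∃ q, IsEqualizer M q := by
  set c : Option (Fin n) → ℝ := fun o => (bordered M).det⁻¹ * (bordered M).adjugate o none with hc
  have h : bordered M *ᵥ c = Pi.single none 1 := by
    have h1 : c = (bordered M).det⁻¹ • ((bordered M).adjugate *ᵥ Pi.single none 1) := by
      ext o
      simp [hc]
    rw [h1, Matrix.mulVec_smul, Matrix.mulVec_mulVec, Matrix.mul_adjugate, Matrix.smul_mulVec,
      Matrix.one_mulVec, smul_smul, inv_mul_cancel₀ hdet, one_smul]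
  have hpos : ∀ j, 0 < c (some j) := fun j => by
    have h1 := hM j
    have h2 : c (some j) = ((bordered M).det * (bordered M).adjugate (some j) none) /
        (bordered M).det ^ 2 := by
      simp only [hc]
      field_simp
    rw [h2]
    positivity
  refine ⟨fun j => c (some j), ⟨fun j => (hpos j).le, ?_⟩, hpos, -c none, funext fun i => ?_⟩
  · rw [← bordered_mulVec_none M, h]
    simp
  · have := congrFun h (some i)
    rw [bordered_mulVec_some] at this
    simpa using eq_neg_of_add_eq_zero_left this

/-- For an equalizer the product is det² · q_j, so one strict polynomial inequality encodes both
invertibility and positivity. Openness is then immediate. -/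
theorem mem_completelyMixedMatrices_iff [NeZero n] :
    M ∈ completelyMixedMatrices n ↔
      (∀ j, 0 < (bordered M).det * (bordered M).adjugate (some j) none) ∧
      ∀ j, 0 < (bordered Mᵀ).det * (bordered Mᵀ).adjugate (some j) none := by
  constructor
  · intro h
    have hdet := det_bordered_ne_zero_of_existsUnique h
    have hdet' : (bordered Mᵀ).det ≠ 0 := by rwa [det_bordered_transpose]
    obtain ⟨x, hx, -⟩ := h
    rw [isCompletelyMixed_iff] at hx
    have key : ∀ {N : Matrix (Fin n) (Fin n) ℝ} {q : Fin n → ℝ}, (bordered N).det ≠ 0 →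
        IsEqualizer N q → ∀ j, 0 < (bordered N).det * (bordered N).adjugate (some j) none := by
      intro N q hN hq j
      rw [hq.adjugate_eq, ← mul_assoc]
      exact mul_pos (mul_self_pos.2 hN) (hq.2.1 j)
    exact ⟨key hdet hx.2, key hdet' hx.1⟩
  · rintro ⟨h1, h2⟩
    have hdet : (bordered M).det ≠ 0 := left_ne_zero_of_mul (h1 0).ne'
    have hdet' : (bordered Mᵀ).det ≠ 0 := by rwa [det_bordered_transpose]
    obtain ⟨q, hq⟩ := exists_isEqualizer hdet h1
    obtain ⟨p, hp⟩ := exists_isEqualizer hdet' h2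
    refine ⟨(p, q), isCompletelyMixed_iff.2 ⟨hp, hq⟩, fun y hy => ?_⟩
    have hy := isCompletelyMixed_iff.1 hy
    exact Prod.ext (hy.1.unique hdet' hp) (hy.2.unique hdet hq)

theorem isOpen_completelyMixedMatrices (n : ℕ) : IsOpen (completelyMixedMatrices n) := by
  rcases eq_or_ne n 0 with rfl | hn
  · convert isOpen_empty
    refine eq_empty_of_forall_notMem fun M hM => ?_
    obtain ⟨x, hx, -⟩ := hM
    simpa using hx.1.1.2
  have : NeZero n := ⟨hn⟩
  have hb : Continuous (bordered : Matrix (Fin n) (Fin n) ℝ → _) := continuous_bordered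
  have hb' : Continuous fun M : Matrix (Fin n) (Fin n) ℝ => bordered Mᵀ :=
    hb.comp continuous_id.matrix_transpose
  have : completelyMixedMatrices n =
      (⋂ j, {M | 0 < (bordered M).det * (bordered M).adjugate (some j) none}) ∩
      ⋂ j, {M | 0 < (bordered Mᵀ).det * (bordered Mᵀ).adjugate (some j) none} := by
    ext M
    simp [mem_completelyMixedMatrices_iff]
  rw [this]
  exact (isOpen_iInter_of_finite fun j => isOpen_lt continuous_const
    (hb.matrix_det.mul (hb.matrix_adjugate.matrix_elem _ _))).inter
    (isOpen_iInter_of_finite fun j => isOpen_lt continuous_const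
    (hb'.matrix_det.mul (hb'.matrix_adjugate.matrix_elem _ _)))

end completelyMixed

/-! ### Faces of the simplex and the support function -/

/-- The set of maximizers over the simplex of the linear function with coefficients `u`. -/
def maxFace {n : ℕ} (u : Fin n → ℝ) : Set (Fin n → ℝ) :=
  {x | x ∈ stdSimplex ℝ (Fin n) ∧ ∀ y ∈ stdSimplex ℝ (Fin n), y ⬝ᵥ u ≤ x ⬝ᵥ u}

/-- The maximum over the simplex of the linear function with coefficients `u`. -/
noncomputable def simplexMax {n : ℕ} (u : Fin n → ℝ) : ℝ :=
  sSup ((fun a : Fin n → ℝ => a ⬝ᵥ u) '' stdSimplex ℝ (Fin n))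

section face
variable {n : ℕ} {u x : Fin n → ℝ}

theorem single_mem_maxFace {k : Fin n} (hk : ∀ j, u j ≤ u k) : Pi.single k 1 ∈ maxFace u := by
  refine ⟨single_mem_stdSimplex ℝ k, fun y hy => ?_⟩
  rw [single_one_dotProduct]
  calc y ⬝ᵥ u ≤ ∑ j, y j * u k :=
        Finset.sum_le_sum fun j _ => mul_le_mul_of_nonneg_left (hk j) (hy.1 j)
    _ = u k := by rw [← Finset.sum_mul, hy.2, one_mul]

theorem maxFace_nonempty [NeZero n] (u : Fin n → ℝ) : (maxFace u).Nonempty := by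
  obtain ⟨k, hk⟩ := Finite.exists_max u
  exact ⟨_, single_mem_maxFace hk⟩

theorem simplexMax_eq (hx : x ∈ maxFace u) : simplexMax u = x ⬝ᵥ u := by
  refine IsGreatest.csSup_eq ⟨⟨x, hx.1, rfl⟩, ?_⟩
  rintro _ ⟨y, hy, rfl⟩
  exact hx.2 y hy

theorem dotProduct_le_simplexMax [NeZero n] (hx : x ∈ stdSimplex ℝ (Fin n)) :
    x ⬝ᵥ u ≤ simplexMax u := by
  obtain ⟨z, hz⟩ := maxFace_nonempty u
  rw [simplexMax_eq hz]
  exact hz.2 x hx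

theorem mem_maxFace_of_simplexMax_le [NeZero n] (hx : x ∈ stdSimplex ℝ (Fin n))
    (h : simplexMax u ≤ x ⬝ᵥ u) : x ∈ maxFace u :=
  ⟨hx, fun _ hy => (dotProduct_le_simplexMax hy).trans h⟩

/-- Mass sitting on a coordinate that is not maximal could be moved to a larger one, raising the
value. -/
theorem mem_maxFace_iff :
    x ∈ maxFace u ↔ x ∈ stdSimplex ℝ (Fin n) ∧ ∀ i, x i ≠ 0 → ∀ k, u k ≤ u i := by
  constructor
  · refine fun hx => ⟨hx.1, fun i hi k => ?_⟩
    by_contra! hlt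
    have hne : i ≠ k := by rintro rfl; exact lt_irrefl _ hlt
    have hxi : 0 < x i := lt_of_le_of_ne (hx.1.1 i) (Ne.symm hi)
    have hmem : x + x i • (Pi.single k 1 - Pi.single i 1) ∈ stdSimplex ℝ (Fin n) := by
      refine ⟨fun j => ?_, ?_⟩
      · have := hx.1.1 j
        by_cases hji : j = i
        · subst hji; simp [hne]
        · by_cases hjk : j = k
          · subst hjk; simp [Ne.symm hne]; linarith
          · simp [hji, hjk, this]
      · simp [Finset.sum_add_distrib, ← Finset.mul_sum, hx.1.2]
    have := hx.2 _ hmem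
    rw [add_dotProduct, smul_dotProduct, sub_dotProduct, single_one_dotProduct,
      single_one_dotProduct, smul_eq_mul] at this
    nlinarith
  · rintro ⟨hx, h⟩
    refine ⟨hx, fun y hy => ?_⟩
    obtain ⟨i, hi⟩ : ∃ i, x i ≠ 0 := by
      by_contra! h0
      have := hx.2
      simp [h0] at this
    have h1 : y ⬝ᵥ u ≤ u i := by
      calc y ⬝ᵥ u ≤ ∑ j, y j * u i :=
            Finset.sum_le_sum fun j _ => mul_le_mul_of_nonneg_left (h i hi j) (hy.1 j)
        _ = u i := by rw [← Finset.sum_mul, hy.2, one_mul]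
    have h2 : u i = x ⬝ᵥ u := by
      calc u i = ∑ j, x j * u i := by rw [← Finset.sum_mul, hx.2, one_mul]
        _ = x ⬝ᵥ u := Finset.sum_congr rfl fun j _ => by
            by_cases hj : x j = 0
            · simp [hj]
            · rw [le_antisymm (h j hj i) (h i hi j)]
    exact h1.trans h2.le

theorem isCompact_maxFace (u : Fin n → ℝ) : IsCompact (maxFace u) := by
  refine (isCompact_stdSimplex ℝ (Fin n)).of_isClosed_subset ?_ fun x hx => hx.1
  have : maxFace u = stdSimplex ℝ (Fin n) ∩
      ⋂ y ∈ stdSimplex ℝ (Fin n), {x | y ⬝ᵥ u ≤ x ⬝ᵥ u} := by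
    ext x; simp [maxFace]
  rw [this]
  refine (isClosed_stdSimplex ℝ (Fin n)).inter (isClosed_biInter fun y _ =>
    isClosed_le continuous_const ?_)
  simp only [dotProduct]
  fun_prop

theorem convex_maxFace (u : Fin n → ℝ) : Convex ℝ (maxFace u) := by
  intro x hx y hy a b ha hb hab
  refine ⟨convex_stdSimplex ℝ (Fin n) hx.1 hy.1 ha hb hab, fun z hz => ?_⟩
  rw [add_dotProduct, smul_dotProduct, smul_dotProduct, smul_eq_mul, smul_eq_mul]
  have h1 := mul_le_mul_of_nonneg_left (hx.2 z hz) ha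
  have h2 := mul_le_mul_of_nonneg_left (hy.2 z hz) hb
  have h3 : z ⬝ᵥ u = a * z ⬝ᵥ u + b * z ⬝ᵥ u := by rw [← add_mul, hab, one_mul]
  linarith

/-- Strict inequalities between coordinates persist under perturbation. This is upper semicontinuity
in the exact form available for polytopes: inclusion in the face itself, not in a neighbourhood of
it. -/
theorem eventually_maxFace_subset (u : Fin n → ℝ) :
    ∀ᶠ w in nhds u, maxFace w ⊆ maxFace u := by
  have h : ∀ᶠ w in nhds u, ∀ i k, u i < u k → w i < w k := by
    refine Filter.eventually_all.2 fun i => Filter.eventually_all.2 fun k => ?_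
    by_cases hik : u i < u k
    · filter_upwards [(continuous_apply i).continuousAt.eventually_lt
        (continuous_apply k).continuousAt hik] with w hw _ using hw
    · exact Filter.Eventually.of_forall fun w h => absurd h hik
  filter_upwards [h] with w hw x hx
  rw [mem_maxFace_iff] at hx ⊢
  exact ⟨hx.1, fun i hi k => le_of_not_gt fun hlt => absurd (hw i k hlt) (hx.2 i hi k).not_gt⟩

theorem maxFace_smul {c : ℝ} (hc : 0 < c) (u : Fin n → ℝ) : maxFace (c • u) = maxFace u := by
  ext x
  simp [maxFace, dotProduct_smul, hc]

theorem maxFace_add_const (u : Fin n → ℝ) (c : ℝ) : maxFace (u + fun _ => c) = maxFace u := by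
  ext x
  simp [mem_maxFace_iff]

theorem dotProduct_const_of_mem_stdSimplex (hx : x ∈ stdSimplex ℝ (Fin n)) (c : ℝ) :
    x ⬝ᵥ (fun _ => c) = c := by
  simp [dotProduct, ← Finset.sum_mul, hx.2]

theorem simplexMax_add_const [NeZero n] (u : Fin n → ℝ) (c : ℝ) :
    simplexMax (u + fun _ => c) = simplexMax u + c := by
  obtain ⟨x, hx⟩ := maxFace_nonempty u
  rw [simplexMax_eq hx, simplexMax_eq ((maxFace_add_const u c).symm ▸ hx), dotProduct_add,
    dotProduct_const_of_mem_stdSimplex hx.1]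

theorem simplexMax_smul [NeZero n] {c : ℝ} (hc : 0 ≤ c) (u : Fin n → ℝ) :
    simplexMax (c • u) = c * simplexMax u := by
  obtain ⟨x, hx⟩ := maxFace_nonempty u
  rw [simplexMax_eq hx, simplexMax_eq (x := x) ⟨hx.1, fun y hy => ?_⟩, dotProduct_smul, smul_eq_mul]
  rw [dotProduct_smul, dotProduct_smul, smul_eq_mul, smul_eq_mul]
  exact mul_le_mul_of_nonneg_left (hx.2 y hy) hc

theorem abs_dotProduct_le_norm (hx : x ∈ stdSimplex ℝ (Fin n)) (u : Fin n → ℝ) :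
    |x ⬝ᵥ u| ≤ ‖u‖ := by
  calc |x ⬝ᵥ u| ≤ ∑ i, |x i * u i| := Finset.abs_sum_le_sum_abs _ _
    _ ≤ ∑ i, x i * ‖u‖ := Finset.sum_le_sum fun i _ => by
        rw [abs_mul, abs_of_nonneg (hx.1 i)]
        exact mul_le_mul_of_nonneg_left (norm_le_pi_norm u i) (hx.1 i)
    _ = ‖u‖ := by rw [← Finset.sum_mul, hx.2, one_mul]

theorem lipschitzWith_simplexMax [NeZero n] : LipschitzWith 1 (simplexMax (n := n)) := by
  refine LipschitzWith.of_le_add fun u w => ?_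
  obtain ⟨x, hx⟩ := maxFace_nonempty u
  have h1 := dotProduct_le_simplexMax (u := w) hx.1
  have h2 := (abs_le.1 (abs_dotProduct_le_norm hx.1 (u - w))).2
  rw [dotProduct_sub] at h2
  rw [simplexMax_eq hx, dist_eq_norm]
  linarith

end face

/-! ### Best responses and the Hamiltonian -/

/-- The pairs of best responses at `z = (p, q)`. -/
def bestResponse {n : ℕ} (M : Matrix (Fin n) (Fin n) ℝ) (z : PhaseSpace n) :
    Set (PhaseSpace n) :=
  bestResponseP M z.2 ×ˢ bestResponseQ M z.1

section bestResponse
variable {n : ℕ} (M : Matrix (Fin n) (Fin n) ℝ) (z : PhaseSpace n)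

theorem bestResponse_eq :
    bestResponse M z = maxFace (M *ᵥ z.2) ×ˢ maxFace (-(z.1 ᵥ* M)) := by
  ext v
  simp [bestResponse, bestResponseP, bestResponseQ, maxFace, Matrix.dotProduct_mulVec z.1,
    dotProduct_comm (z.1 ᵥ* M)]

theorem gameHamiltonian_eq :
    gameHamiltonian M z = simplexMax (M *ᵥ z.2) + simplexMax (-(z.1 ᵥ* M)) := by
  have h : (fun b : Fin n → ℝ => b ⬝ᵥ (-(z.1 ᵥ* M))) '' stdSimplex ℝ (Fin n) =
      -((fun b : Fin n → ℝ => z.1 ⬝ᵥ (M *ᵥ b)) '' stdSimplex ℝ (Fin n)) := by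
    ext r
    simp [Matrix.dotProduct_mulVec z.1, dotProduct_comm (z.1 ᵥ* M), neg_eq_iff_eq_neg]
  rw [gameHamiltonian, simplexMax, simplexMax, h, Real.sSup_neg]
  rfl

theorem isCompact_bestResponse : IsCompact (bestResponse M z) := by
  rw [bestResponse_eq]
  exact (isCompact_maxFace _).prod (isCompact_maxFace _)

theorem convex_bestResponse : Convex ℝ (bestResponse M z) := by
  rw [bestResponse_eq]
  exact (convex_maxFace _).prod (convex_maxFace _)

theorem bestResponse_subset : bestResponse M z ⊆ strategyPairs n :=
  fun _ hv => ⟨hv.1.1, hv.2.1⟩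

/-- The base point 0 makes statements about faces global: its saddles are the Nash equilibria, and
mean velocities of weak solutions always lie in its face. -/
theorem bestResponse_zero : bestResponse M 0 = strategyPairs n := by
  ext v
  simp [bestResponse, bestResponseP, bestResponseQ, strategyPairs]

theorem continuous_mulVec_snd : Continuous fun z : PhaseSpace n => M *ᵥ z.2 :=
  continuous_const.matrix_mulVec continuous_snd

theorem continuous_neg_vecMul_fst : Continuous fun z : PhaseSpace n => -(z.1 ᵥ* M) :=
  (continuous_fst.matrix_vecMul continuous_const).neg

theorem eventually_bestResponse_subset :
    ∀ᶠ w in nhds z, bestResponse M w ⊆ bestResponse M z := by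
  filter_upwards [(continuous_mulVec_snd M).continuousAt.eventually
    (eventually_maxFace_subset (M *ᵥ z.2)),
    (continuous_neg_vecMul_fst M).continuousAt.eventually
    (eventually_maxFace_subset (-(z.1 ᵥ* M)))] with w h1 h2
  rw [bestResponse_eq, bestResponse_eq]
  exact prod_mono h1 h2

theorem bestResponse_smul {c : ℝ} (hc : 0 < c) : bestResponse M (c • z) = bestResponse M z := by
  rw [bestResponse_eq, bestResponse_eq, Prod.smul_snd, Prod.smul_fst, Matrix.mulVec_smul,
    Matrix.smul_vecMul, ← smul_neg, maxFace_smul hc, maxFace_smul hc]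

/-- The symmetry behind time reversal. -/
theorem bestResponse_neg_neg : bestResponse (-M) (-z) = bestResponse M z := by
  rw [bestResponse_eq, bestResponse_eq]
  simp [Matrix.neg_mulVec, Matrix.mulVec_neg, Matrix.neg_vecMul, Matrix.vecMul_neg]

theorem gameHamiltonian_neg_neg : gameHamiltonian (-M) (-z) = gameHamiltonian M z := by
  rw [gameHamiltonian_eq, gameHamiltonian_eq]
  simp [Matrix.neg_mulVec, Matrix.mulVec_neg, Matrix.neg_vecMul, Matrix.vecMul_neg]

variable [NeZero n]

theorem bestResponse_nonempty : (bestResponse M z).Nonempty := by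
  rw [bestResponse_eq]
  exact (maxFace_nonempty _).prod (maxFace_nonempty _)

theorem continuous_gameHamiltonian : Continuous (gameHamiltonian M) := by
  have : gameHamiltonian M = fun z => simplexMax (M *ᵥ z.2) + simplexMax (-(z.1 ᵥ* M)) :=
    funext fun z => gameHamiltonian_eq M z
  rw [this]
  exact (lipschitzWith_simplexMax.continuous.comp (continuous_mulVec_snd M)).add
    (lipschitzWith_simplexMax.continuous.comp (continuous_neg_vecMul_fst M))

theorem gameHamiltonian_smul {c : ℝ} (hc : 0 ≤ c) :
    gameHamiltonian M (c • z) = c * gameHamiltonian M z := by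
  rw [gameHamiltonian_eq, gameHamiltonian_eq, Prod.smul_snd, Prod.smul_fst, Matrix.mulVec_smul,
    Matrix.smul_vecMul, ← smul_neg, simplexMax_smul hc, simplexMax_smul hc, mul_add]

end bestResponse

/-! ### Saddle points on faces of best responses -/

/-- `v` is a saddle point of the payoff on the face of best responses at `z`. -/
def IsSaddle {n : ℕ} (M : Matrix (Fin n) (Fin n) ℝ) (z v : PhaseSpace n) : Prop :=
  v ∈ bestResponse M z ∧
    ∀ w ∈ bestResponse M z, w.1 ⬝ᵥ (M *ᵥ v.2) ≤ v.1 ⬝ᵥ (M *ᵥ w.2)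

/-- There is at most one saddle point on each face of best responses. -/
def HasUniqueSaddles {n : ℕ} (M : Matrix (Fin n) (Fin n) ℝ) : Prop :=
  ∀ z v w, IsSaddle M z v → IsSaddle M z w → v = w

section saddle
variable {n : ℕ} {M : Matrix (Fin n) (Fin n) ℝ}

theorem exists_isSaddle [NeZero n] (M : Matrix (Fin n) (Fin n) ℝ) (z : PhaseSpace n) :
    ∃ v, IsSaddle M z v := by
  have hc1 : ∀ x : Fin n → ℝ, Continuous fun y : Fin n → ℝ => x ⬝ᵥ (M *ᵥ y) := fun x =>
    continuous_const.dotProduct (continuous_const.matrix_mulVec continuous_id)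
  have hc2 : ∀ y : Fin n → ℝ, Continuous fun x : Fin n → ℝ => x ⬝ᵥ (M *ᵥ y) := fun y =>
    continuous_id.dotProduct continuous_const
  obtain ⟨b, hb, a, ha, hab⟩ := Sion.exists_isSaddlePointOn
    (X := maxFace (-(z.1 ᵥ* M))) (Y := maxFace (M *ᵥ z.2)) (f := fun y x => x ⬝ᵥ (M *ᵥ y))
    (maxFace_nonempty _) (convex_maxFace _) (isCompact_maxFace _)
    (fun x _ => (hc1 x).continuousOn.lowerSemicontinuousOn)
    (fun x _ => ConvexOn.quasiconvexOn ⟨convex_maxFace _, fun y _ y' _ a b _ _ _ => by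
      simp [Matrix.mulVec_add, Matrix.mulVec_smul]⟩)
    (convex_maxFace _) (maxFace_nonempty _) (isCompact_maxFace _)
    (fun y _ => (hc2 y).continuousOn.upperSemicontinuousOn)
    (fun y _ => ConcaveOn.quasiconcaveOn ⟨convex_maxFace _, fun x _ x' _ a b _ _ _ => by
      simp⟩)
  refine ⟨(a, b), ?_, fun w hw => ?_⟩
  · rw [bestResponse_eq]
    exact ⟨ha, hb⟩
  · rw [bestResponse_eq] at hw
    exact hab w.2 hw.2 w.1 hw.1

/-- A best response along which the Hamiltonian does not change is a saddle point. -/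
theorem isSaddle_of_gameHamiltonian_eq [NeZero n] {z v : PhaseSpace n}
    (hv : v ∈ bestResponse M z) {s : ℝ} (hs : 0 < s)
    (h : gameHamiltonian M (z + s • v) = gameHamiltonian M z) : IsSaddle M z v := by
  refine ⟨hv, fun w hw => ?_⟩
  rw [bestResponse_eq] at hw
  -- Testing the maxima at `z + s • v` with `w` gives H(z + sv) ≥ H(z) + s (w₁'Mv₂ - v₁'Mw₂); with H
  -- unchanged, the bracket is at most 0.
  have h1 := dotProduct_le_simplexMax (u := M *ᵥ (z + s • v).2) hw.1.1
  have h2 := dotProduct_le_simplexMax (u := -((z + s • v).1 ᵥ* M)) hw.2.1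
  have h3 : w.2 ⬝ᵥ (v.1 ᵥ* M) = v.1 ⬝ᵥ (M *ᵥ w.2) := by
    rw [Matrix.dotProduct_mulVec, dotProduct_comm]
  rw [gameHamiltonian_eq, gameHamiltonian_eq M z, simplexMax_eq hw.1, simplexMax_eq hw.2] at h
  simp only [Prod.snd_add, Prod.smul_snd, Prod.fst_add, Prod.smul_fst, Matrix.mulVec_add,
    Matrix.mulVec_smul, Matrix.add_vecMul, Matrix.smul_vecMul, dotProduct_add, dotProduct_neg,
    dotProduct_smul, smul_eq_mul, h3] at h h1 h2
  have h4 : s * (w.1 ⬝ᵥ (M *ᵥ v.2)) ≤ s * (v.1 ⬝ᵥ (M *ᵥ w.2)) := by linarith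
  exact le_of_mul_le_mul_left h4 hs

/-- Moving along a saddle point for a short time keeps it a best response and does not change the
Hamiltonian. -/
theorem IsSaddle.exists_pos [NeZero n] {z v : PhaseSpace n} (hv : IsSaddle M z v) :
    ∃ δ > (0 : ℝ), ∀ s ∈ Icc 0 δ, gameHamiltonian M (z + s • v) = gameHamiltonian M z ∧
      v ∈ bestResponse M (z + s • v) := by
  have hc : Continuous fun s : ℝ => z + s • v := by fun_prop
  have hev := hc.continuousAt (x := 0) |>.eventually
    (p := fun w => bestResponse M w ⊆ bestResponse M z)
    (by simpa using eventually_bestResponse_subset M z)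
  obtain ⟨δ, hδ, hball⟩ := Metric.eventually_nhds_iff.1 hev
  refine ⟨δ / 2, by positivity, fun s hs => ?_⟩
  have hsub : bestResponse M (z + s • v) ⊆ bestResponse M z := hball (by
    rw [Real.dist_eq, sub_zero, abs_of_nonneg hs.1]; linarith [hs.2])
  -- A best response `w` at the new point ties with `v` at `z` and, by the saddle property, gains
  -- nothing over `v` in the direction `v`; so `v` is a best response there too.
  obtain ⟨w, hw⟩ := bestResponse_nonempty M (z + s • v)
  have hwz := hsub hw
  have hvz := hv.1
  have s1 := hv.2 (w.1, v.2) ⟨hwz.1, hv.1.2⟩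
  have s2 := hv.2 (v.1, w.2) ⟨hv.1.1, hwz.2⟩
  rw [bestResponse_eq] at hw hvz hwz
  have h3 : ∀ a b : PhaseSpace n, a.2 ⬝ᵥ (b.1 ᵥ* M) = b.1 ⬝ᵥ (M *ᵥ a.2) := fun a b => by
    rw [Matrix.dotProduct_mulVec, dotProduct_comm]
  have e1 : w.1 ⬝ᵥ (M *ᵥ z.2) = v.1 ⬝ᵥ (M *ᵥ z.2) := by
    rw [← simplexMax_eq hvz.1, ← simplexMax_eq hwz.1]
  have e2 : w.2 ⬝ᵥ (-(z.1 ᵥ* M)) = v.2 ⬝ᵥ (-(z.1 ᵥ* M)) := by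
    rw [← simplexMax_eq hvz.2, ← simplexMax_eq hwz.2]
  have m1 : v.1 ∈ maxFace (M *ᵥ (z + s • v).2) := by
    refine mem_maxFace_of_simplexMax_le hvz.1.1 ?_
    rw [simplexMax_eq hw.1]
    simp only [Prod.snd_add, Prod.smul_snd, Matrix.mulVec_add, Matrix.mulVec_smul, dotProduct_add,
      dotProduct_smul, smul_eq_mul, e1]
    gcongr
    exact hs.1
  have m2 : v.2 ∈ maxFace (-((z + s • v).1 ᵥ* M)) := by
    refine mem_maxFace_of_simplexMax_le hvz.2.1 ?_
    rw [simplexMax_eq hw.2]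
    have := mul_le_mul_of_nonneg_left s2 hs.1
    simp only [Prod.fst_add, Prod.smul_fst, Matrix.add_vecMul, Matrix.smul_vecMul, dotProduct_neg,
      dotProduct_add, dotProduct_smul, smul_eq_mul, h3] at e2 this ⊢
    linarith
  refine ⟨?_, by rw [bestResponse_eq]; exact ⟨m1, m2⟩⟩
  rw [gameHamiltonian_eq, gameHamiltonian_eq, simplexMax_eq m1, simplexMax_eq m2,
    simplexMax_eq hvz.1, simplexMax_eq hvz.2]
  simp only [Prod.fst_add, Prod.smul_fst, Matrix.add_vecMul, Matrix.smul_vecMul, dotProduct_neg,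
    Prod.snd_add, Prod.smul_snd, Matrix.mulVec_add, Matrix.mulVec_smul,
    dotProduct_add, dotProduct_smul, smul_eq_mul, h3]
  ring

theorem IsSaddle.interchange {z v w : PhaseSpace n} (hv : IsSaddle M z v) (hw : IsSaddle M z w) :
    IsSaddle M z (v.1, w.2) :=
  ⟨⟨hv.1.1, hw.1.2⟩, fun a ha => (hw.2 (a.1, v.2) ⟨ha.1, hv.1.2⟩).trans
    (hv.2 (w.1, a.2) ⟨hw.1.1, ha.2⟩)⟩

/-- Complementary slackness: values that never exceed their own weighted mean must equal it wherever
the weight is nonzero. -/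
theorem eq_dotProduct_of_forall_le {x w : Fin n → ℝ} (hx : x ∈ stdSimplex ℝ (Fin n))
    (h : ∀ i, x i ≠ 0 → w i ≤ x ⬝ᵥ w) (i : Fin n) (hi : x i ≠ 0) : w i = x ⬝ᵥ w := by
  have h0 : ∑ j, x j * (x ⬝ᵥ w - w j) = 0 := by
    simp only [mul_sub, Finset.sum_sub_distrib, ← Finset.sum_mul, hx.2, one_mul]
    exact sub_self _
  have h1 := (Finset.sum_eq_zero_iff_of_nonneg fun j _ => ?_).1 h0 i (Finset.mem_univ i)
  · rcases mul_eq_zero.1 h1 with h2 | h2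
    · exact absurd h2 hi
    · linarith
  · by_cases hj : x j = 0
    · simp [hj]
    · exact mul_nonneg (hx.1 j) (sub_nonneg.2 (h j hj))

theorem single_mem_maxFace_of_ne_zero {u x : Fin n → ℝ} (hx : x ∈ maxFace u) {i : Fin n}
    (hi : x i ≠ 0) : Pi.single i 1 ∈ maxFace u :=
  single_mem_maxFace ((mem_maxFace_iff.1 hx).2 i hi)

theorem IsSaddle.mulVec_eq {z v : PhaseSpace n} (hv : IsSaddle M z v) (i : Fin n)
    (hi : v.1 i ≠ 0) : (M *ᵥ v.2) i = v.1 ⬝ᵥ (M *ᵥ v.2) := by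
  refine eq_dotProduct_of_forall_le hv.1.1.1 (fun i hi => ?_) i hi
  have := hv.2 (Pi.single i 1, v.2) ⟨single_mem_maxFace_of_ne_zero hv.1.1 hi, hv.1.2⟩
  simpa using this

theorem IsSaddle.vecMul_eq {z v : PhaseSpace n} (hv : IsSaddle M z v) (j : Fin n)
    (hj : v.2 j ≠ 0) : (v.1 ᵥ* M) j = v.1 ⬝ᵥ (M *ᵥ v.2) := by
  have hvz := hv.1
  rw [bestResponse_eq] at hvz
  have h := eq_dotProduct_of_forall_le (w := -(v.1 ᵥ* M)) hvz.2.1 (fun i hi => ?_) j hj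
  · rw [dotProduct_neg, dotProduct_comm, ← Matrix.dotProduct_mulVec] at h
    simpa using h
  · have := hv.2 (v.1, Pi.single i 1) ⟨hv.1.1, by
      have := single_mem_maxFace_of_ne_zero hvz.2 hi
      have h2 : (v.1, Pi.single i 1) ∈ bestResponse M z := by
        rw [bestResponse_eq]; exact ⟨hvz.1, this⟩
      exact h2.2⟩
    rw [dotProduct_neg, dotProduct_comm, ← Matrix.dotProduct_mulVec, Pi.neg_apply, neg_le_neg_iff]
    rwa [Matrix.dotProduct_mulVec v.1 M (Pi.single i 1), dotProduct_single_one] at this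

/-- The number of rows that a vector can equalize is bounded in terms of its support. -/
structure SupportBound (M : Matrix (Fin n) (Fin n) ℝ) : Prop where
  card_le : ∀ y : Fin n → ℝ, y ≠ 0 → ∀ v, (Finset.univ.filter fun i => (M *ᵥ y) i = v).card ≤
    (Finset.univ.filter fun j => y j ≠ 0).card
  card_lt : ∀ d : Fin n → ℝ, d ≠ 0 → ∑ j, d j = 0 → ∀ v,
    (Finset.univ.filter fun i => (M *ᵥ d) i = v).card <
      (Finset.univ.filter fun j => d j ≠ 0).card

theorem IsGenericMatrix.supportBound (hM : IsGenericMatrix M) : SupportBound M :=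
  ⟨fun _ hy v => hM.card_le_card_support hy v, fun _ hd hd0 v => hM.card_lt_card_support hd hd0 v⟩

theorem SupportBound.neg (hM : SupportBound M) : SupportBound (-M) := by
  constructor
  · intro y hy v
    simpa [Matrix.neg_mulVec, neg_eq_iff_eq_neg] using hM.card_le y hy (-v)
  · intro d hd hd0 v
    simpa [Matrix.neg_mulVec, neg_eq_iff_eq_neg] using hM.card_lt d hd hd0 (-v)

/-- Let J be the columns equalized by `x`. Then |supp x| ≤ |supp y|, |supp y'|, both supports lie in
J, and |J| ≤ |supp x|; so both supports equal J. If `y ≠ y'`, the sum-zero vector `y - y'`,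
supported in J, equalizes at least |J| rows, contrary to `card_lt`. -/
theorem SupportBound.eq_of_equalizes (hM : SupportBound M) (hMt : SupportBound Mᵀ)
    {x y y' : Fin n → ℝ} (hx : ∑ i, x i = 1) (hy : ∑ i, y i = 1) (hy' : ∑ i, y' i = 1) {c : ℝ}
    (h1 : ∀ i, x i ≠ 0 → (M *ᵥ y) i = c) (h2 : ∀ i, x i ≠ 0 → (M *ᵥ y') i = c)
    (h3 : ∀ j, y j ≠ 0 → (Mᵀ *ᵥ x) j = c) (h4 : ∀ j, y' j ≠ 0 → (Mᵀ *ᵥ x) j = c) : y = y' := by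
  have hne : ∀ {w : Fin n → ℝ}, ∑ i, w i = 1 → w ≠ 0 := by
    rintro w hw rfl
    simp at hw
  by_contra hyy
  have hd := hM.card_lt (y - y') (sub_ne_zero.2 hyy) (by simp [hy, hy']) 0
  set X := Finset.univ.filter fun i => x i ≠ 0
  set Y := Finset.univ.filter fun i => y i ≠ 0
  set Y' := Finset.univ.filter fun i => y' i ≠ 0
  set J := Finset.univ.filter fun j => (Mᵀ *ᵥ x) j = c
  have a1 : X.card ≤ Y.card := (Finset.card_le_card fun i hi => by
    simpa using h1 i (by simpa [X] using hi)).trans (hM.card_le y (hne hy) c)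
  have a2 : X.card ≤ Y'.card := (Finset.card_le_card fun i hi => by
    simpa using h2 i (by simpa [X] using hi)).trans (hM.card_le y' (hne hy') c)
  have b1 : Y ⊆ J := fun j hj => by simpa [J] using h3 j (by simpa [Y] using hj)
  have b2 : Y' ⊆ J := fun j hj => by simpa [J] using h4 j (by simpa [Y'] using hj)
  have b3 : J.card ≤ X.card := hMt.card_le x (hne hx) c
  have c1 : Y = J := Finset.eq_of_subset_of_card_le b1 (b3.trans a1)
  have c2 : Y' = J := Finset.eq_of_subset_of_card_le b2 (b3.trans a2)
  have d1 : X.card ≤ (Finset.univ.filter fun i => (M *ᵥ (y - y')) i = 0).card :=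
    Finset.card_le_card fun i hi => by
      have hi' : x i ≠ 0 := by simpa [X] using hi
      simp [Matrix.mulVec_sub, h1 i hi', h2 i hi']
  have d2 : (Finset.univ.filter fun j => (y - y') j ≠ 0).card ≤ J.card :=
    Finset.card_le_card fun j hj => by
      by_contra hJ
      have e1 : y j = 0 := by rw [← c1] at hJ; simpa [Y] using hJ
      have e2 : y' j = 0 := by rw [← c2] at hJ; simpa [Y'] using hJ
      simp [e1, e2] at hj
  omega

theorem SupportBound.hasUniqueSaddles (hM : SupportBound M) (hMt : SupportBound Mᵀ) :
    HasUniqueSaddles M := by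
  -- Saddles are exchangeable and share one value, so each component can be compared with its rival
  -- against the same opposing strategy.
  have key : ∀ {z v w : PhaseSpace n}, IsSaddle M z v → IsSaddle M z w →
      v.1 ⬝ᵥ (M *ᵥ w.2) = v.1 ⬝ᵥ (M *ᵥ v.2) := fun {z v w} hv hw =>
    le_antisymm ((hv.interchange hw).2 v hv.1) (hv.2 (v.1, w.2) ⟨hv.1.1, hw.1.2⟩)
  have key2 : ∀ {z v w : PhaseSpace n}, IsSaddle M z v → IsSaddle M z w →
      w.1 ⬝ᵥ (M *ᵥ v.2) = v.1 ⬝ᵥ (M *ᵥ v.2) := fun {z v w} hv hw =>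
    le_antisymm (hv.2 (w.1, v.2) ⟨hw.1.1, hv.1.2⟩) ((hw.interchange hv).2 v hv.1)
  intro z v w hv hw
  have hvw := hv.interchange hw
  have hwv := hw.interchange hv
  refine Prod.ext ?_ ?_
  · refine hMt.eq_of_equalizes (by simpa using hM) (x := v.2) (c := v.1 ⬝ᵥ (M *ᵥ v.2)) hv.1.2.1.2
      hv.1.1.1.2 hw.1.1.1.2 ?_ ?_ ?_ ?_
    · intro j hj
      rw [Matrix.mulVec_transpose, hv.vecMul_eq j hj]
    · intro j hj
      rw [Matrix.mulVec_transpose, ← key2 hv hw]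
      exact hwv.vecMul_eq j hj
    · intro i hi
      rw [Matrix.transpose_transpose, hv.mulVec_eq i hi]
    · intro i hi
      rw [Matrix.transpose_transpose, ← key2 hv hw]
      exact hwv.mulVec_eq i hi
  · refine hM.eq_of_equalizes hMt (x := v.1) (c := v.1 ⬝ᵥ (M *ᵥ v.2)) hv.1.1.1.2
      hv.1.2.1.2 hw.1.2.1.2 ?_ ?_ ?_ ?_
    · exact fun i hi => hv.mulVec_eq i hi
    · intro i hi
      rw [← key hv hw]
      exact hvw.mulVec_eq i hi
    · intro j hj
      rw [Matrix.mulVec_transpose, hv.vecMul_eq j hj]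
    · intro j hj
      rw [Matrix.mulVec_transpose, ← key hv hw]
      exact hvw.vecMul_eq j hj

end saddle

/-! ### Weak solutions: local form, uniqueness and existence -/

/-- A derivative-free formulation of `dZ/dt ∈ BR(Z)` on `S`: the Hamiltonian is constant along `Z`,
and as long as the best responses stay in one face, so does the average velocity of `Z`. -/
def IsWeakSolution {n : ℕ} (M : Matrix (Fin n) (Fin n) ℝ) (S : Set ℝ) (Z : ℝ → PhaseSpace n) :
    Prop :=
  ∀ s ∈ S, ∀ t ∈ S, s ≤ t → gameHamiltonian M (Z s) = gameHamiltonian M (Z t) ∧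
    ∀ w, (∀ r ∈ Icc s t, bestResponse M (Z r) ⊆ bestResponse M w) →
      ∃ v ∈ bestResponse M w, Z t - Z s = (t - s) • v

theorem norm_le_one_of_mem_strategyPairs {n : ℕ} {v : PhaseSpace n} (hv : v ∈ strategyPairs n) :
    ‖v‖ ≤ 1 := by
  have h : ∀ x ∈ stdSimplex ℝ (Fin n), ‖x‖ ≤ 1 := fun x hx =>
    (pi_norm_le_iff_of_nonneg zero_le_one).2 fun i => by
      rw [Real.norm_eq_abs, abs_of_nonneg (hx.1 i)]
      exact (mem_Icc_of_mem_stdSimplex hx i).2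
  exact (Prod.norm_def v).trans_le (max_le (h _ hv.1) (h _ hv.2))

namespace IsWeakSolution
variable {n : ℕ} {M : Matrix (Fin n) (Fin n) ℝ} {S : Set ℝ} {Z Z' : ℝ → PhaseSpace n}

theorem mono (hZ : IsWeakSolution M S Z) {S' : Set ℝ} (h : S' ⊆ S) : IsWeakSolution M S' Z :=
  fun s hs t ht hst => hZ s (h hs) t (h ht) hst

theorem congr (hZ : IsWeakSolution M S Z) (hS : S.OrdConnected) (h : EqOn Z Z' S) :
    IsWeakSolution M S Z' := by
  intro s hs t ht hst
  rw [← h hs, ← h ht]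
  refine ⟨(hZ s hs t ht hst).1, fun w hw => (hZ s hs t ht hst).2 w fun r hr => ?_⟩
  rw [h (hS.out hs ht hr)]
  exact hw r hr

theorem comp_add_const (hZ : IsWeakSolution M S Z) (c : ℝ) :
    IsWeakSolution M {t | t + c ∈ S} fun t => Z (t + c) := by
  intro s hs t ht hst
  obtain ⟨h1, h2⟩ := hZ (s + c) hs (t + c) ht (by linarith)
  refine ⟨h1, fun w hw => ?_⟩
  obtain ⟨v, hv, h⟩ := h2 w fun r hr => by
    simpa using hw (r - c) ⟨by linarith [hr.1], by linarith [hr.2]⟩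
  exact ⟨v, hv, by rw [h]; congr 1; ring⟩

/-- The map Z(t) ↦ -Z(-t) preserves velocities, while the passage from `M` to `-M` restores the
faces. -/
theorem neg (hZ : IsWeakSolution M S Z) :
    IsWeakSolution (-M) {t | -t ∈ S} fun t => -Z (-t) := by
  intro s hs t ht hst
  obtain ⟨h1, h2⟩ := hZ (-t) ht (-s) hs (by linarith)
  refine ⟨by simp only [gameHamiltonian_neg_neg, h1], fun w hw => ?_⟩
  obtain ⟨v, hv, h⟩ := h2 (-w) fun r hr => by
    have := hw (-r) ⟨by linarith [hr.2], by linarith [hr.1]⟩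
    rw [← bestResponse_neg_neg M (-w), neg_neg]
    simpa only [neg_neg, bestResponse_neg_neg] using this
  refine ⟨v, by rwa [← bestResponse_neg_neg M (-w), neg_neg] at hv, ?_⟩
  rw [neg_sub_neg, h]
  congr 1
  ring

theorem smul [NeZero n] (hZ : IsWeakSolution M S Z) {k : ℝ} (hk : 0 < k) :
    IsWeakSolution M {t | k * t ∈ S} fun t => k⁻¹ • Z (k * t) := by
  intro s hs t ht hst
  have hk' : 0 < k⁻¹ := inv_pos.2 hk
  obtain ⟨h1, h2⟩ := hZ (k * s) hs (k * t) ht (mul_le_mul_of_nonneg_left hst hk.le)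
  refine ⟨by rw [gameHamiltonian_smul M _ hk'.le, gameHamiltonian_smul M _ hk'.le, h1],
    fun w hw => ?_⟩
  obtain ⟨v, hv, h⟩ := h2 w fun r hr => by
    have := hw (k⁻¹ * r) ⟨by rw [le_inv_mul_iff₀ hk]; exact hr.1,
      by rw [inv_mul_le_iff₀ hk]; exact hr.2⟩
    rwa [bestResponse_smul M _ hk', mul_inv_cancel_left₀ hk.ne'] at this
  refine ⟨v, hv, ?_⟩
  rw [← smul_sub, h, smul_smul]
  congr 1
  field_simp

theorem add_const (hZ : IsWeakSolution M S Z) {e : PhaseSpace n} {a : ℝ}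
    (hbr : ∀ z, bestResponse M (z + e) = bestResponse M z)
    (hH : ∀ z, gameHamiltonian M (z + e) = gameHamiltonian M z + a) :
    IsWeakSolution M S fun t => Z t + e := by
  intro s hs t ht hst
  obtain ⟨h1, h2⟩ := hZ s hs t ht hst
  refine ⟨by simp only [hH, h1], fun w hw => ?_⟩
  simp only [hbr] at hw
  simpa only [add_sub_add_right_eq_sub] using h2 w hw

theorem exists_strategyPairs (hZ : IsWeakSolution M S Z) {s t : ℝ} (hs : s ∈ S) (ht : t ∈ S)
    (hst : s ≤ t) : ∃ v ∈ strategyPairs n, Z t - Z s = (t - s) • v := by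
  rw [← bestResponse_zero M]
  exact (hZ s hs t ht hst).2 0 fun r _ => by
    rw [bestResponse_zero]; exact bestResponse_subset M _

theorem lipschitzOnWith (hZ : IsWeakSolution M S Z) : LipschitzOnWith 1 Z S := by
  have key : ∀ s ∈ S, ∀ t ∈ S, s ≤ t → dist (Z s) (Z t) ≤ dist s t := by
    intro s hs t ht hst
    obtain ⟨v, hv, h⟩ := hZ.exists_strategyPairs hs ht hst
    rw [dist_comm, dist_eq_norm, h, norm_smul, dist_comm, Real.dist_eq, ← Real.norm_eq_abs]
    exact mul_le_of_le_one_right (norm_nonneg _) (norm_le_one_of_mem_strategyPairs hv)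
  refine LipschitzOnWith.of_dist_le_mul fun s hs t ht => ?_
  rw [NNReal.coe_one, one_mul]
  rcases le_total s t with h | h
  · exact key s hs t ht h
  · rw [dist_comm, dist_comm s]
    exact key t ht s hs h

theorem union {c : ℝ} (h1 : IsWeakSolution M (S ∩ Iic c) Z) (h2 : IsWeakSolution M (S ∩ Ici c) Z)
    (hc : c ∈ S) : IsWeakSolution M S Z := by
  intro s hs t ht hst
  rcases le_total t c with htc | htc
  · exact h1 s ⟨hs, hst.trans htc⟩ t ⟨ht, htc⟩ hst
  rcases le_total c s with hcs | hcs
  · exact h2 s ⟨hs, hcs⟩ t ⟨ht, htc⟩ hst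
  obtain ⟨a1, a2⟩ := h1 s ⟨hs, hcs⟩ c ⟨hc, mem_Iic.2 le_rfl⟩ hcs
  obtain ⟨b1, b2⟩ := h2 c ⟨hc, mem_Ici.2 le_rfl⟩ t ⟨ht, htc⟩ htc
  refine ⟨a1.trans b1, fun w hw => ?_⟩
  obtain ⟨v, hv, hv'⟩ := a2 w fun r hr => hw r ⟨hr.1, hr.2.trans htc⟩
  obtain ⟨u, hu, hu'⟩ := b2 w fun r hr => hw r ⟨hcs.trans hr.1, hr.2⟩
  rcases hst.eq_or_lt with rfl | hlt
  · exact ⟨v, hv, by simp⟩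
  have hts : 0 < t - s := sub_pos.2 hlt
  -- The mean velocity over the union is the time-weighted average of the two, and faces are convex.
  refine ⟨((c - s) / (t - s)) • v + ((t - c) / (t - s)) • u,
    convex_bestResponse M w hv hu (div_nonneg (by linarith) hts.le)
      (div_nonneg (by linarith) hts.le) (by field_simp; ring), ?_⟩
  rw [smul_add, smul_smul, smul_smul, mul_div_cancel₀ _ hts.ne', mul_div_cancel₀ _ hts.ne', ← hv',
    ← hu']
  abel

variable [NeZero n]

/-- Weak solutions move along the saddle points on the faces of best responses. -/
theorem exists_pos_eq_add_smul (hM : HasUniqueSaddles M) {a b : ℝ} (hab : a < b)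
    (hZ : IsWeakSolution M (Icc a b) Z) {v : PhaseSpace n} (hv : IsSaddle M (Z a) v) :
    ∃ δ > 0, a + δ ≤ b ∧ ∀ s ∈ Icc 0 δ, Z (a + s) = Z a + s • v := by
  obtain ⟨ε, hε, hball⟩ := Metric.eventually_nhds_iff.1 (eventually_bestResponse_subset M (Z a))
  refine ⟨min (ε / 2) (b - a), lt_min (by positivity) (by linarith),
    by linarith [min_le_right (ε / 2) (b - a)], fun s hs => ?_⟩
  have hs1 : s ≤ ε / 2 := hs.2.trans (min_le_left _ _)
  have hs2 : s ≤ b - a := hs.2.trans (min_le_right _ _)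
  have ha : a ∈ Icc a b := ⟨le_rfl, hab.le⟩
  rcases hs.1.eq_or_lt with rfl | hs0
  · simp
  obtain ⟨h1, h2⟩ := hZ a ha (a + s) ⟨by linarith, by linarith⟩ (by linarith)
  obtain ⟨w, hw, h⟩ := h2 (Z a) fun r hr => hball <| by
    have := hZ.lipschitzOnWith.dist_le_mul r ⟨hr.1, by linarith [hr.2]⟩ a ha
    rw [NNReal.coe_one, one_mul, Real.dist_eq, abs_of_nonneg (by linarith [hr.1])] at this
    linarith [hr.2]
  rw [add_sub_cancel_left, sub_eq_iff_eq_add'] at h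
  rw [h] at h1 ⊢
  rw [hM _ _ _ hv (isSaddle_of_gameHamiltonian_eq hw hs0 h1.symm)]

theorem eqOn (hM : HasUniqueSaddles M) {a b : ℝ} (hZ : IsWeakSolution M (Icc a b) Z)
    (hZ' : IsWeakSolution M (Icc a b) Z') (h : Z a = Z' a) : EqOn Z Z' (Icc a b) := by
  have hcl : IsClosed ({t | Z t = Z' t} ∩ Icc a b) := by
    have := (hZ.lipschitzOnWith.continuousOn.prodMk
      hZ'.lipschitzOnWith.continuousOn).preimage_isClosed_of_isClosed isClosed_Icc
      (isClosed_eq continuous_fst continuous_snd)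
    rwa [inter_comm] at this
  -- Continuous induction: from a common point both curves leave along the segment of the same
  -- saddle.
  refine fun t ht => hcl.Icc_subset_of_forall_exists_gt h (fun x hx y hy => ?_) ht
  obtain ⟨v, hv⟩ := exists_isSaddle M (Z x)
  have hsub : Icc x b ⊆ Icc a b := Icc_subset_Icc_left hx.2.1
  obtain ⟨δ, hδ, -, h1⟩ := (hZ.mono hsub).exists_pos_eq_add_smul hM hx.2.2 hv
  have hxx : Z x = Z' x := hx.1
  obtain ⟨δ', hδ', -, h2⟩ := (hZ'.mono hsub).exists_pos_eq_add_smul hM hx.2.2 (hxx ▸ hv)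
  have hy' : 0 < y - x := sub_pos.2 hy
  set η := min (min δ δ') (y - x) with hη
  have hη0 : 0 < η := lt_min (lt_min hδ hδ') hy'
  refine ⟨x + η, ?_, by linarith, by linarith [min_le_right (min δ δ') (y - x)]⟩
  have e1 := h1 η ⟨hη0.le, (min_le_left _ _).trans (min_le_left _ _)⟩
  have e2 := h2 η ⟨hη0.le, (min_le_left _ _).trans (min_le_right _ _)⟩
  change Z (x + η) = Z' (x + η)
  rw [e1, e2, hxx]

theorem of_isSaddle {z v : PhaseSpace n} (hv : IsSaddle M z v) :
    ∃ δ > 0, IsWeakSolution M (Icc 0 δ) fun s => z + s • v := by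
  obtain ⟨δ, hδ, h⟩ := hv.exists_pos
  refine ⟨δ, hδ, fun s hs t ht hst => ⟨by rw [(h s hs).1, (h t ht).1], fun w hw => ?_⟩⟩
  refine ⟨v, hw s ⟨le_rfl, hst⟩ (h s hs).2, ?_⟩
  rw [add_sub_add_left_eq_sub, sub_smul]

/-- Continuity of the Hamiltonian and closedness of faces let both conditions pass to the limit at
the endpoint. -/
theorem Icc_of_Ico {a b : ℝ} (hZ : IsWeakSolution M (Ico a b) Z)
    (hc : ContinuousOn Z (Icc a b)) : IsWeakSolution M (Icc a b) Z := by
  intro s hs t ht hst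
  rcases hst.eq_or_lt with rfl | hlt
  · refine ⟨rfl, fun w hw => ?_⟩
    obtain ⟨v, hv⟩ := bestResponse_nonempty M (Z s)
    exact ⟨v, hw s ⟨le_rfl, le_rfl⟩ hv, by simp⟩
  have hsb : s < b := hlt.trans_le ht.2
  have htend : Filter.Tendsto Z (nhdsWithin t (Ioo s t)) (nhds (Z t)) :=
    (hc t ht).mono_left (nhdsWithin_mono _ fun r hr =>
      ⟨hs.1.trans hr.1.le, hr.2.le.trans ht.2⟩)
  have hne : (nhdsWithin t (Ioo s t)).NeBot := by
    rw [← mem_closure_iff_nhdsWithin_neBot, closure_Ioo hlt.ne]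
    exact ⟨hlt.le, le_rfl⟩
  have hev : ∀ r ∈ Ioo s t, r ∈ Ico a b := fun r hr =>
    ⟨hs.1.trans hr.1.le, hr.2.trans_le ht.2⟩
  refine ⟨?_, fun w hw => ?_⟩
  · have h1 := ((continuous_gameHamiltonian M).tendsto (Z t)).comp htend
    refine tendsto_nhds_unique (tendsto_const_nhds.congr' ?_) h1
    filter_upwards [self_mem_nhdsWithin] with r hr
    exact (hZ s ⟨hs.1, hsb⟩ r (hev r hr) hr.1.le).1
  · refine ⟨(t - s)⁻¹ • (Z t - Z s), ?_, by
      rw [smul_smul, mul_inv_cancel₀ (sub_pos.2 hlt).ne', one_smul]⟩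
    have h2 : Filter.Tendsto (fun r => (r - s)⁻¹ • (Z r - Z s)) (nhdsWithin t (Ioo s t))
        (nhds ((t - s)⁻¹ • (Z t - Z s))) := by
      refine Filter.Tendsto.smul ?_ (htend.sub_const _)
      exact ((Filter.Tendsto.mono_left Filter.tendsto_id nhdsWithin_le_nhds).sub_const s).inv₀
        (sub_pos.2 hlt).ne'
    refine (isCompact_bestResponse M w).isClosed.mem_of_tendsto h2 ?_
    filter_upwards [self_mem_nhdsWithin] with r hr
    obtain ⟨v, hv, h⟩ := (hZ s ⟨hs.1, hsb⟩ r (hev r hr) hr.1.le).2 w fun τ hτ =>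
      hw τ ⟨hτ.1, hτ.2.trans hr.2.le⟩
    rwa [h, smul_smul, inv_mul_cancel₀ (sub_pos.2 hr.1).ne', one_smul]

end IsWeakSolution

namespace IsWeakSolution
variable {n : ℕ} {M : Matrix (Fin n) (Fin n) ℝ} [NeZero n]

/-- Solutions on bounded intervals fit together. -/
theorem exists_of_forall_Icc (hM : HasUniqueSaddles M) (z : PhaseSpace n) {I : Set ℝ}
    (h0 : (0 : ℝ) ∈ I) (hI : ∀ t ∈ I, 0 ≤ t ∧ Icc 0 t ⊆ I)
    (h : ∀ t ∈ I, ∃ Z, Z 0 = z ∧ IsWeakSolution M (Icc 0 t) Z) :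
    ∃ Z, Z 0 = z ∧ IsWeakSolution M I Z := by
  choose! Z hZ0 hZ using h
  -- Uniqueness makes the solutions on different intervals agree, so the diagonal is a single
  -- solution.
  refine ⟨fun t => Z t t, hZ0 0 h0, fun s hs t ht hst => ?_⟩
  have heq : EqOn (Z t) (fun r => Z r r) (Icc 0 t) := fun r hr => by
    have hrI := (hI t ht).2 hr
    exact ((hZ t ht).mono (Icc_subset_Icc_right hr.2)).eqOn hM (hZ r hrI)
      ((hZ0 t ht).trans (hZ0 r hrI).symm) ⟨hr.1, le_rfl⟩
  exact (hZ t ht).congr ordConnected_Icc heq s ⟨(hI s hs).1, hst⟩ t ⟨(hI t ht).1, le_rfl⟩ hst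

theorem exists_Icc (hM : HasUniqueSaddles M) (z : PhaseSpace n) {T : ℝ} (hT : 0 ≤ T) :
    ∃ Z, Z 0 = z ∧ IsWeakSolution M (Icc 0 T) Z := by
  set P : Set ℝ := {t | ∃ Z, Z 0 = z ∧ IsWeakSolution M (Icc 0 t) Z} with hP
  have hdown : ∀ t ∈ P, ∀ s ≤ t, s ∈ P := by
    rintro t ⟨Z, hZ0, hZ⟩ s hs
    exact ⟨Z, hZ0, hZ.mono (Icc_subset_Icc_right hs)⟩
  have hP0 : (0 : ℝ) ∈ P := by
    refine ⟨fun _ => z, rfl, fun s hs t ht hst => ⟨rfl, fun w hw => ?_⟩⟩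
    obtain ⟨v, hv⟩ := bestResponse_nonempty M z
    have : t = s := by linarith [hs.1, ht.2]
    exact ⟨v, hw s ⟨le_rfl, hst⟩ hv, by simp [this]⟩
  have hlim : ∀ t, 0 < t → (∀ s, 0 ≤ s → s < t → s ∈ P) → t ∈ P := by
    intro t ht h
    obtain ⟨Z, hZ0, hZ⟩ := exists_of_forall_Icc hM z (I := Ico 0 t) ⟨le_rfl, ht⟩
      (fun r hr => ⟨hr.1, fun s hs => ⟨hs.1, hs.2.trans_lt hr.2⟩⟩) fun r hr => h r hr.1 hr.2
    -- Weak solutions are Lipschitz, so the one on `Ico 0 t` has a continuous extension to `t`.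
    obtain ⟨C, g, hg, hgZ⟩ : ∃ (C : NNReal) (g : ℝ → PhaseSpace n), LipschitzWith C g ∧
        EqOn Z g (Ico 0 t) := ⟨_, hZ.lipschitzOnWith.extend_finite_dimension⟩
    exact ⟨g, (hgZ ⟨le_rfl, ht⟩).symm.trans hZ0,
      (hZ.congr ordConnected_Ico hgZ).Icc_of_Ico hg.continuous.continuousOn⟩
  have hcl : IsClosed (P ∩ Icc 0 T) := by
    refine isClosed_of_closure_subset fun t ht => ?_
    have htI : t ∈ Icc 0 T := closure_minimal inter_subset_right isClosed_Icc ht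
    refine ⟨?_, htI⟩
    rcases htI.1.eq_or_lt with rfl | h0
    · exact hP0
    refine hlim t h0 fun s _ hst => ?_
    obtain ⟨r, hr, hrP⟩ := mem_closure_iff.1 ht (Ioi s) isOpen_Ioi hst
    exact hdown r hrP.1 s (le_of_lt hr)
  refine hcl.Icc_subset_of_forall_exists_gt hP0 (fun t ht y hy => ?_) ⟨hT, le_rfl⟩
  obtain ⟨⟨Z, hZ0, hZ⟩, ht0, -⟩ := ht
  obtain ⟨v, hv⟩ := exists_isSaddle M (Z t)
  obtain ⟨δ, hδ, hseg⟩ := of_isSaddle hv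
  have hη : 0 < min δ (y - t) := lt_min hδ (sub_pos.2 hy)
  refine ⟨t + min δ (y - t), ?_, by linarith, by linarith [min_le_right δ (y - t)]⟩
  -- At the final point the solution is prolonged by a saddle segment.
  set Z' : ℝ → PhaseSpace n := fun s => if s ≤ t then Z s else Z t + (s - t) • v with hZ'
  refine hdown (t + δ) ⟨Z', by simp [hZ', ht0, hZ0], ?_⟩ _ (by linarith [min_le_left δ (y - t)])
  refine union (c := t) ?_ ?_ ⟨ht0, by linarith⟩
  · refine (hZ.congr ordConnected_Icc fun s hs => ?_).mono fun s hs => ⟨hs.1.1, hs.2⟩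
    simp [hZ', hs.2]
  · refine ((hseg.comp_add_const (-t)).mono fun s hs => ?_).congr
      (ordConnected_Icc.inter ordConnected_Ici) fun s hs => ?_
    · have h1 := hs.1.2
      have h2 : t ≤ s := hs.2
      exact ⟨by linarith, by linarith⟩
    · rcases (show t ≤ s from hs.2).eq_or_lt with rfl | hlt
      · simp [hZ']
      · simp [hZ', not_le.2 hlt, sub_eq_add_neg]

theorem exists_Ici (hM : HasUniqueSaddles M) (z : PhaseSpace n) :
    ∃ Z, Z 0 = z ∧ IsWeakSolution M (Ici 0) Z :=
  exists_of_forall_Icc hM z (mem_Ici.2 le_rfl) (fun _ ht => ⟨ht, Icc_subset_Ici_self⟩)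
    fun _ ht => exists_Icc hM z ht

theorem exists_univ (hM : HasUniqueSaddles M) (hM' : HasUniqueSaddles (-M)) (z : PhaseSpace n) :
    ∃ Z, Z 0 = z ∧ IsWeakSolution M univ Z := by
  obtain ⟨Z, hZ0, hZ⟩ := exists_Ici hM z
  obtain ⟨Z', hZ'0, hZ'⟩ := exists_Ici hM' (-z)
  have hneg := hZ'.neg
  rw [neg_neg] at hneg
  refine ⟨fun t => if t ≤ 0 then -Z' (-t) else Z t, by simp [hZ'0], union (c := 0) ?_ ?_ trivial⟩
  · rw [univ_inter]
    refine (hneg.mono fun t ht => ?_).congr ordConnected_Iic fun t ht => ?_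
    · exact neg_nonneg.2 (mem_Iic.1 ht)
    · simp [mem_Iic.1 ht]
  · rw [univ_inter]
    refine hZ.congr ordConnected_Ici fun t ht => ?_
    rcases (mem_Ici.1 ht).eq_or_lt with rfl | h
    · simp [hZ'0, hZ0]
    · simp [not_le.2 h]

theorem eqOn_of_zero (hM : HasUniqueSaddles M) (hM' : HasUniqueSaddles (-M))
    {Z Z' : ℝ → PhaseSpace n} {a b : ℝ} (ha : a ≤ 0) (hb : 0 ≤ b)
    (hZ : IsWeakSolution M (Icc a b) Z) (hZ' : IsWeakSolution M (Icc a b) Z')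
    (h : Z 0 = Z' 0) : EqOn Z Z' (Icc a b) := by
  intro t ht
  rcases le_total 0 t with h0 | h0
  · exact (hZ.mono (Icc_subset_Icc_left ha)).eqOn hM (hZ'.mono (Icc_subset_Icc_left ha)) h
      ⟨h0, ht.2⟩
  · have hsub : Icc 0 (-a) ⊆ {t | -t ∈ Icc a b} := fun s hs =>
      ⟨by linarith [hs.2], by linarith [hs.1]⟩
    have := (hZ.neg.mono hsub).eqOn hM' (hZ'.neg.mono hsub) (by simp [h])
      (x := -t) ⟨by linarith, by linarith [ht.1]⟩
    simpa using this

end IsWeakSolution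

/-! ### The game flow, its symmetries and its continuity -/

/-- `Φ` is the flow of `dZ/dt ∈ BR(Z)` on the whole phase space. -/
structure IsGameFlow {n : ℕ} (M : Matrix (Fin n) (Fin n) ℝ) (Φ : ℝ → PhaseSpace n → PhaseSpace n) :
    Prop where
  zero : ∀ z, Φ 0 z = z
  weak : ∀ z, IsWeakSolution M univ fun t => Φ t z
  eq_of_weak : ∀ (Z : ℝ → PhaseSpace n) (a b : ℝ), a ≤ 0 → 0 ≤ b → IsWeakSolution M (Icc a b) Z →
    ∀ t ∈ Icc a b, Z t = Φ t (Z 0)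

theorem exists_isGameFlow {n : ℕ} [NeZero n] {M : Matrix (Fin n) (Fin n) ℝ}
    (hM : HasUniqueSaddles M) (hM' : HasUniqueSaddles (-M)) : ∃ Φ, IsGameFlow M Φ := by
  choose Z hZ0 hZ using IsWeakSolution.exists_univ hM hM'
  refine ⟨fun t z => Z z t, hZ0, hZ, fun Y a b ha hb hY t ht => ?_⟩
  exact hY.eqOn_of_zero hM hM' ha hb ((hZ (Y 0)).mono (subset_univ _)) (hZ0 _).symm ht

namespace IsGameFlow
variable {n : ℕ} {M : Matrix (Fin n) (Fin n) ℝ} {Φ : ℝ → PhaseSpace n → PhaseSpace n}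

theorem eq_of_weak_univ (h : IsGameFlow M Φ) {Z : ℝ → PhaseSpace n}
    (hZ : IsWeakSolution M univ Z) (t : ℝ) : Z t = Φ t (Z 0) :=
  h.eq_of_weak Z (min t 0) (max t 0) (min_le_right _ _) (le_max_right _ _)
    (hZ.mono (subset_univ _)) t ⟨min_le_left _ _, le_max_left _ _⟩

theorem map_add (h : IsGameFlow M Φ) (s t : ℝ) (z : PhaseSpace n) :
    Φ (s + t) z = Φ s (Φ t z) := by
  have := h.eq_of_weak_univ ((h.weak z).comp_add_const t) s
  simpa using this

theorem map_smul [NeZero n] (h : IsGameFlow M Φ) {k : ℝ} (hk : 0 < k) (t : ℝ) (z : PhaseSpace n) :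
    Φ (k * t) (k • z) = k • Φ t z := by
  have := h.eq_of_weak_univ ((h.weak (k • z)).smul hk) t
  simp only [mul_zero, h.zero, smul_smul, inv_mul_cancel₀ hk.ne', one_smul] at this
  rw [← this, smul_smul, mul_inv_cancel₀ hk.ne', one_smul]

theorem map_add_const (h : IsGameFlow M Φ) {e : PhaseSpace n} {a : ℝ}
    (hbr : ∀ z, bestResponse M (z + e) = bestResponse M z)
    (hH : ∀ z, gameHamiltonian M (z + e) = gameHamiltonian M z + a) (t : ℝ) (z : PhaseSpace n) :
    Φ t (z + e) = Φ t z + e := by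
  have := h.eq_of_weak_univ ((h.weak z).add_const hbr hH) t
  simpa only [h.zero] using this.symm

theorem gameHamiltonian_eq (h : IsGameFlow M Φ) (t : ℝ) (z : PhaseSpace n) :
    gameHamiltonian M (Φ t z) = gameHamiltonian M z := by
  rcases le_total 0 t with h0 | h0
  · simpa only [h.zero] using (h.weak z 0 trivial t trivial h0).1.symm
  · simpa only [h.zero] using (h.weak z t trivial 0 trivial h0).1

theorem lipschitzWith (h : IsGameFlow M Φ) (z : PhaseSpace n) :
    LipschitzWith 1 fun t => Φ t z :=
  lipschitzOnWith_univ.1 (h.weak z).lipschitzOnWith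

theorem exists_strategyPairs (h : IsGameFlow M Φ) {t : ℝ} (ht : 0 ≤ t) (z : PhaseSpace n) :
    ∃ v ∈ strategyPairs n, Φ t z = z + t • v := by
  obtain ⟨v, hv, hv'⟩ := (h.weak z).exists_strategyPairs (mem_univ 0) (mem_univ t) ht
  refine ⟨v, hv, ?_⟩
  rw [h.zero, sub_zero, sub_eq_iff_eq_add'] at hv'
  exact hv'

theorem neg (h : IsGameFlow M Φ) : IsGameFlow (-M) fun t z => -Φ (-t) (-z) := by
  refine ⟨fun z => by simp [h.zero], fun z => ?_, fun Z a b ha hb hZ t ht => ?_⟩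
  · simpa using (h.weak (-z)).neg
  · have := hZ.neg
    rw [neg_neg] at this
    have := h.eq_of_weak _ (-b) (-a) (by linarith) (by linarith)
      (this.mono fun s hs => ⟨by linarith [hs.2], by linarith [hs.1]⟩) (-t)
      ⟨by linarith [ht.2], by linarith [ht.1]⟩
    simp only [neg_neg, neg_zero] at this
    rw [← this, neg_neg]

variable [NeZero n]

/-- Near a point the flow follows the saddle points of one face, hence it is continuous there
for a short time. -/
theorem exists_pos_continuousAt (h : IsGameFlow M Φ) (hM : HasUniqueSaddles M)
    (z₀ : PhaseSpace n) : ∃ δ > 0, ∀ t ∈ Icc 0 δ, ContinuousAt (Φ t) z₀ := by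
  obtain ⟨ε, hε, hball⟩ := Metric.eventually_nhds_iff.1 (eventually_bestResponse_subset M z₀)
  -- Starting within ε/3 and moving at speed at most 1 for time ε/3 stays within ε of `z₀`, where
  -- best responses lie in its face.
  refine ⟨ε / 3, by positivity, fun t ht => ?_⟩
  rcases ht.1.eq_or_lt with rfl | ht0
  · exact continuousAt_id.congr (Filter.Eventually.of_forall fun z => (h.zero z).symm)
  set f : PhaseSpace n → PhaseSpace n := fun z => t⁻¹ • (Φ t z - z) with hf
  have hΦ : ∀ z, Φ t z = z + t • f z := fun z => by
    simp only [hf]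
    rw [smul_smul, mul_inv_cancel₀ ht0.ne', one_smul, add_sub_cancel]
  have hfmem : ∀ᶠ z in nhds z₀, f z ∈ bestResponse M z₀ := by
    filter_upwards [Metric.ball_mem_nhds z₀ (show 0 < ε / 3 by positivity)] with z hz
    obtain ⟨v, hv, hv'⟩ := (h.weak z 0 trivial t trivial ht0.le).2 z₀ fun r hr => hball <| by
      have h1 := (h.lipschitzWith z).dist_le_mul r 0
      simp only [h.zero, NNReal.coe_one, one_mul, Real.dist_eq, sub_zero, abs_of_nonneg hr.1] at h1
      have h2 := dist_triangle (Φ r z) z z₀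
      have h3 : dist z z₀ < ε / 3 := hz
      linarith [hr.2, ht.2]
    simp only [h.zero, sub_zero] at hv'
    change t⁻¹ • (Φ t z - z) ∈ _
    rwa [hv', smul_smul, inv_mul_cancel₀ ht0.ne', one_smul]
  obtain ⟨v, hv⟩ := exists_isSaddle M z₀
  -- Mean velocities stay in a compact face, and by continuity of H every cluster point leaves H
  -- unchanged, hence is the unique saddle there.
  have htend : Filter.Tendsto f (nhds z₀) (nhds v) := by
    refine (isCompact_bestResponse M z₀).tendsto_nhds_of_unique_mapClusterPt hfmem
      fun y hy hcl => ?_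
    obtain ⟨U, hU, hUf⟩ := mapClusterPt_iff_ultrafilter.1 hcl
    have hz : Filter.Tendsto (fun z : PhaseSpace n => z) U (nhds z₀) := hU
    have h1 := ((continuous_gameHamiltonian M).tendsto _).comp (hz.add (hUf.const_smul t))
    have h2 := ((continuous_gameHamiltonian M).tendsto _).comp hz
    refine hM z₀ y v (isSaddle_of_gameHamiltonian_eq hy ht0 (tendsto_nhds_unique
      (h1.congr fun z => ?_) h2)) hv
    change gameHamiltonian M (z + t • f z) = gameHamiltonian M z
    rw [← hΦ, h.gameHamiltonian_eq]
  have hlim : Filter.Tendsto (fun z => z + t • f z) (nhds z₀) (nhds (z₀ + t • v)) :=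
    Filter.Tendsto.add Filter.tendsto_id (htend.const_smul t)
  -- The neighbourhood filter is not punctured, so the limit is also the value at `z₀`.
  have hfv : f z₀ = v := (tendsto_nhds_unique (htend.comp (tendsto_pure_nhds id z₀))
    (tendsto_pure_nhds f z₀)).symm
  rw [ContinuousAt, hΦ z₀, hfv]
  exact hlim.congr fun z => (hΦ z).symm

/-- The times at which `Φ` is continuous at `z₀` form a closed set, the time dependence being
Lipschitz uniformly in the point. The semigroup law and short-time continuity extend it to the
right. -/
theorem continuous_apply_of_nonneg (h : IsGameFlow M Φ) (hM : HasUniqueSaddles M) {t : ℝ}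
    (ht : 0 ≤ t) : Continuous (Φ t) := by
  refine continuous_iff_continuousAt.2 fun z₀ => ?_
  have hcl : IsClosed ({s | ContinuousAt (Φ s) z₀} ∩ Icc 0 t) := by
    refine IsClosed.inter (isClosed_of_closure_subset fun s hs => ?_) isClosed_Icc
    refine continuousAt_of_locally_uniform_approx_of_continuousAt fun u hu => ?_
    obtain ⟨ε, hε, hεu⟩ := Metric.mem_uniformity_dist.1 hu
    obtain ⟨r, hr, hsr⟩ := Metric.mem_closure_iff.1 hs ε hε
    refine ⟨univ, Filter.univ_mem, Φ r, hr, fun z _ => hεu ?_⟩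
    have := (h.lipschitzWith z).dist_le_mul s r
    rw [NNReal.coe_one, one_mul] at this
    exact this.trans_lt hsr
  refine hcl.Icc_subset_of_forall_exists_gt ?_ (fun s hs y hy => ?_) ⟨ht, le_rfl⟩
  · exact continuousAt_id.congr (Filter.Eventually.of_forall fun z => (h.zero z).symm)
  · obtain ⟨δ, hδ, hδc⟩ := h.exists_pos_continuousAt hM (Φ s z₀)
    have hη : 0 < min δ (y - s) := lt_min hδ (sub_pos.2 hy)
    refine ⟨s + min δ (y - s), ?_, by linarith, by linarith [min_le_right δ (y - s)]⟩
    have := (hδc _ ⟨hη.le, min_le_left _ _⟩).comp (show ContinuousAt (Φ s) z₀ from hs.1)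
    refine this.congr (Filter.Eventually.of_forall fun z => ?_)
    rw [add_comm, h.map_add]
    rfl

theorem continuous (h : IsGameFlow M Φ) (hM : HasUniqueSaddles M) (hM' : HasUniqueSaddles (-M)) :
    Continuous fun p : ℝ × PhaseSpace n => Φ p.1 p.2 := by
  refine continuous_prod_of_continuous_lipschitzWith (fun p : ℝ × PhaseSpace n => Φ p.1 p.2) 1
    (fun t => ?_) fun z => h.lipschitzWith z
  rcases le_total 0 t with ht | ht
  · exact h.continuous_apply_of_nonneg hM ht
  · have := h.neg.continuous_apply_of_nonneg hM' (t := -t) (by linarith)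
    exact (this.comp continuous_neg).neg.congr fun z => by simp

end IsGameFlow

/-! ### From absolutely continuous solutions to weak ones and back -/

theorem AbsolutelyContinuousOnInterval.lipschitzWith_comp {X Y : Type*} [PseudoMetricSpace X]
    [PseudoMetricSpace Y] {f : ℝ → X} {g : X → Y} {a b : ℝ} {K : NNReal} (hg : LipschitzWith K g)
    (hf : AbsolutelyContinuousOnInterval f a b) :
    AbsolutelyContinuousOnInterval (fun t => g (f t)) a b := by
  rw [absolutelyContinuousOnInterval_iff] at hf ⊢
  intro ε hε
  obtain ⟨δ, hδ, h⟩ := hf (ε / (K + 1)) (by positivity)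
  refine ⟨δ, hδ, fun E hE hEδ => ?_⟩
  have h1 := h E hE hEδ
  rw [lt_div_iff₀ (by positivity)] at h1
  calc ∑ i ∈ Finset.range E.1, dist (g (f (E.2 i).1)) (g (f (E.2 i).2))
      ≤ ∑ i ∈ Finset.range E.1, K * dist (f (E.2 i).1) (f (E.2 i).2) :=
        Finset.sum_le_sum fun i _ => hg.dist_le_mul _ _
    _ = (∑ i ∈ Finset.range E.1, dist (f (E.2 i).1) (f (E.2 i).2)) * K := by
        rw [← Finset.mul_sum, mul_comm]
    _ ≤ (∑ i ∈ Finset.range E.1, dist (f (E.2 i).1) (f (E.2 i).2)) * (K + 1) := by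
        gcongr
        linarith
    _ < ε := h1

theorem AbsolutelyContinuousOnInterval.le_of_ae_hasDerivAt_nonneg {f : ℝ → ℝ} {a b : ℝ}
    (hab : a ≤ b) (hf : AbsolutelyContinuousOnInterval f a b)
    (h : ∀ᵐ t ∂(volume.restrict (Icc a b)), ∃ c ≥ 0, HasDerivAt f c t) : f a ≤ f b := by
  rw [← sub_nonneg, ← hf.integral_deriv_eq_sub]
  refine intervalIntegral.integral_nonneg_of_ae_restrict hab ?_
  filter_upwards [h] with t ht
  obtain ⟨c, hc, hd⟩ := ht
  rw [hd.deriv]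
  exact hc

/-- The envelope principle: `f - g` has a minimum at `t`. It differentiates a maximum along a curve
by freezing a maximizer. -/
theorem HasDerivAt.eq_of_le_of_eq {f g : ℝ → ℝ} {f' g' t : ℝ} (hf : HasDerivAt f f' t)
    (hg : HasDerivAt g g' t) (hle : ∀ r, g r ≤ f r) (heq : g t = f t) : f' = g' := by
  have hmin : IsLocalMin (fun r => f r - g r) t := Filter.Eventually.of_forall fun r => by
    change f t - g t ≤ f r - g r
    linarith [hle r]
  exact sub_eq_zero.1 (hmin.hasDerivAt_eq_zero (hf.sub hg))

section inclusion
variable {n : ℕ} {M : Matrix (Fin n) (Fin n) ℝ}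

/-- `z ↦ x' M q` as a continuous linear map of `z = (p, q)`. -/
noncomputable def payoffSnd (M : Matrix (Fin n) (Fin n) ℝ) (x : Fin n → ℝ) :
    PhaseSpace n →L[ℝ] ℝ :=
  LinearMap.toContinuousLinearMap
    { toFun := fun z => x ⬝ᵥ (M *ᵥ z.2)
      map_add' := fun z w => by simp [Matrix.mulVec_add]
      map_smul' := fun c z => by simp [Matrix.mulVec_smul] }

/-- `z ↦ -p' M y` as a continuous linear map of `z = (p, q)`. -/
noncomputable def negPayoffFst (M : Matrix (Fin n) (Fin n) ℝ) (y : Fin n → ℝ) :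
    PhaseSpace n →L[ℝ] ℝ :=
  LinearMap.toContinuousLinearMap
    { toFun := fun z => y ⬝ᵥ (-(z.1 ᵥ* M))
      map_add' := fun z w => by simp [Matrix.add_vecMul]; ring
      map_smul' := fun c z => by simp [Matrix.smul_vecMul] }

theorem payoffSnd_apply (x : Fin n → ℝ) (z : PhaseSpace n) :
    payoffSnd M x z = x ⬝ᵥ (M *ᵥ z.2) := rfl

theorem negPayoffFst_apply (y : Fin n → ℝ) (z : PhaseSpace n) :
    negPayoffFst M y z = y ⬝ᵥ (-(z.1 ᵥ* M)) := rfl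

theorem exists_lipschitzWith_simplexMax_mulVec [NeZero n] (M : Matrix (Fin n) (Fin n) ℝ) :
    ∃ K, LipschitzWith K fun z : PhaseSpace n => simplexMax (M *ᵥ z.2) :=
  ⟨_, lipschitzWith_simplexMax.comp (LinearMap.toContinuousLinearMap
    (M.mulVecLin ∘ₗ LinearMap.snd ℝ (Fin n → ℝ) (Fin n → ℝ))).lipschitz⟩

theorem exists_lipschitzWith_simplexMax_neg_vecMul [NeZero n] (M : Matrix (Fin n) (Fin n) ℝ) :
    ∃ K, LipschitzWith K fun z : PhaseSpace n => simplexMax (-(z.1 ᵥ* M)) :=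
  ⟨_, lipschitzWith_simplexMax.comp (LinearMap.toContinuousLinearMap
    (-(M.vecMulLinear ∘ₗ LinearMap.fst ℝ (Fin n → ℝ) (Fin n → ℝ)))).lipschitz⟩

variable {Z : ℝ → PhaseSpace n} {C C' : ℝ → ℝ} {a b : ℝ}

/-- The Hamiltonian is constant along solutions of `dZ/dt ∈ C'(t) BR(Z)`. -/
theorem gameHamiltonian_eq_of_ae_mem_bestResponse [NeZero n]
    (hZ : AbsolutelyContinuousOnInterval Z a b)
    (h : ∀ᵐ t ∂(volume.restrict (Icc a b)), ∃ v ∈ bestResponse M (Z t),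
      HasDerivAt Z (C' t • v) t) {s t : ℝ} (hs : s ∈ Icc a b) (ht : t ∈ Icc a b) :
    gameHamiltonian M (Z s) = gameHamiltonian M (Z t) := by
  have hab : a ≤ b := hs.1.trans hs.2
  obtain ⟨K, hK⟩ := exists_lipschitzWith_simplexMax_mulVec M
  obtain ⟨L, hL⟩ := exists_lipschitzWith_simplexMax_neg_vecMul M
  have h1 := hZ.lipschitzWith_comp hK
  have h2 := hZ.lipschitzWith_comp hL
  obtain ⟨c, hc⟩ := (h1.add h2).const_of_ae_hasDerivAt_zero (by
    rw [uIcc_of_le hab]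
    filter_upwards [h1.ae_differentiableAt, h2.ae_differentiableAt,
      (ae_restrict_iff' measurableSet_Icc).1 h] with r hr1 hr2 hr hrI
    obtain ⟨v, hv, hd⟩ := hr hrI
    rw [bestResponse_eq] at hv
    have d1 := (hr1 (uIcc_of_le hab ▸ hrI)).hasDerivAt
    have d2 := (hr2 (uIcc_of_le hab ▸ hrI)).hasDerivAt
    have e1 := d1.eq_of_le_of_eq ((payoffSnd M v.1).hasFDerivAt.comp_hasDerivAt r hd)
      (fun τ => dotProduct_le_simplexMax hv.1.1) (simplexMax_eq hv.1).symm
    have e2 := d2.eq_of_le_of_eq ((negPayoffFst M v.2).hasFDerivAt.comp_hasDerivAt r hd)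
      (fun τ => dotProduct_le_simplexMax hv.2.1) (simplexMax_eq hv.2).symm
    have := d1.add d2
    rw [e1, e2, map_smul, map_smul, payoffSnd_apply, negPayoffFst_apply, dotProduct_neg,
      dotProduct_comm v.2, ← Matrix.dotProduct_mulVec, smul_neg, add_neg_cancel] at this
    exact this)
  rw [uIcc_of_le hab] at hc
  rw [gameHamiltonian_eq, gameHamiltonian_eq]
  exact (hc s hs).trans (hc t ht).symm

/-- If the best responses along a solution of `dZ/dt ∈ C'(t) BR(Z)` stay in one face, so does its
average velocity. -/
theorem exists_mem_bestResponse_of_ae (hZ : AbsolutelyContinuousOnInterval Z a b)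
    (hC : ∀ t, HasDerivAt C (C' t) t) (hC' : ∀ t, 0 < C' t)
    (hCac : AbsolutelyContinuousOnInterval C a b)
    (h : ∀ᵐ t ∂(volume.restrict (Icc a b)), ∃ v ∈ bestResponse M (Z t),
      HasDerivAt Z (C' t • v) t) {s t : ℝ} (hs : s ∈ Icc a b) (ht : t ∈ Icc a b) (hst : s < t)
    {w : PhaseSpace n} (hw : ∀ r ∈ Icc s t, bestResponse M (Z r) ⊆ bestResponse M w) :
    ∃ v ∈ bestResponse M w, Z t - Z s = (C t - C s) • v := by
  have hmono : StrictMono C := strictMono_of_hasDerivAt_pos hC hC'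
  have hpos : 0 < C t - C s := sub_pos.2 (hmono hst)
  refine ⟨(C t - C s)⁻¹ • (Z t - Z s), ?_, by
    rw [smul_smul, mul_inv_cancel₀ hpos.ne', one_smul]⟩
  by_contra hmem
  -- If the mean velocity missed the closed convex face, a functional would separate them; yet `ℓ ∘
  -- Z - c * C` has nonnegative derivative almost everywhere, so it cannot decrease.
  obtain ⟨ℓ, c, hlt, hgt⟩ := geometric_hahn_banach_point_closed (convex_bestResponse M w)
    (isCompact_bestResponse M w).isClosed hmem
  have hsub : Icc s t ⊆ Icc a b := Icc_subset_Icc hs.1 ht.2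
  have husub : uIcc s t ⊆ uIcc a b := by
    rwa [uIcc_of_le hst.le, uIcc_of_le (hs.1.trans hs.2)]
  have hac : AbsolutelyContinuousOnInterval (fun r => ℓ (Z r) - c * C r) s t :=
    ((hZ.mono husub).lipschitzWith_comp ℓ.lipschitz).fun_sub ((hCac.mono husub).const_mul c)
  have hle := hac.le_of_ae_hasDerivAt_nonneg hst.le (by
    have h' := ae_restrict_of_ae_restrict_of_subset hsub h
    filter_upwards [h', ae_restrict_mem measurableSet_Icc] with r hr hrI
    obtain ⟨v, hv, hd⟩ := hr
    refine ⟨_, ?_, (ℓ.hasFDerivAt.comp_hasDerivAt r hd).sub ((hC r).const_mul c)⟩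
    rw [map_smul, smul_eq_mul, mul_comm c, ← mul_sub]
    exact mul_nonneg (hC' r).le (sub_nonneg.2 (hgt v (hw r hrI hv)).le))
  rw [map_smul, smul_eq_mul, map_sub, inv_mul_lt_iff₀ hpos] at hlt
  linarith

/-- A curve with everywhere a right derivative in `F` solves the differential inclusion. -/
theorem isInclusionSolution_of_hasDerivWithinAt_Ici {F : PhaseSpace n → Set (PhaseSpace n)}
    (hZ : AbsolutelyContinuousOnInterval Z a b)
    (h : ∀ t ∈ Icc a b, ∃ v ∈ F (Z t), HasDerivWithinAt Z v (Ici t) t) :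
    IsInclusionSolution F a b Z := by
  refine ⟨hZ, ?_⟩
  filter_upwards [ae_restrict_of_ae (hZ.boundedVariationOn.ae_differentiableAt_of_mem_uIcc),
    ae_restrict_mem measurableSet_Icc] with t ht htI
  obtain ⟨v, hv, hd⟩ := h t htI
  refine ⟨v, hv, ?_⟩
  have h1 := (ht (Icc_subset_uIcc htI)).hasDerivAt
  rwa [(uniqueDiffWithinAt_Ici t).eq_deriv _ h1.hasDerivWithinAt hd] at h1

theorem IsWeakSolution.exists_hasDerivWithinAt_Ici [NeZero n] (hM : HasUniqueSaddles M)
    (hZ : IsWeakSolution M univ Z) (t : ℝ) :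
    ∃ v ∈ bestResponse M (Z t), HasDerivWithinAt Z v (Ici t) t := by
  obtain ⟨v, hv⟩ := exists_isSaddle M (Z t)
  obtain ⟨δ, hδ, -, h⟩ := (hZ.mono (subset_univ (Icc t (t + 1)))).exists_pos_eq_add_smul hM
    (by linarith) hv
  refine ⟨v, hv.1, ?_⟩
  have hlin : HasDerivAt (fun r => Z t + (r - t) • v) v t := by
    simpa using (((hasDerivAt_id t).sub_const t).smul_const v).const_add (Z t)
  refine hlin.hasDerivWithinAt.congr_of_eventuallyEq ?_ (by simp)
  filter_upwards [Icc_mem_nhdsGE (show t < t + δ by linarith)] with r hr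
  rw [← h (r - t) ⟨by linarith [hr.1], by linarith [hr.2]⟩, add_sub_cancel]

end inclusion

/-! ### The equilibrium, the symplectic form and the Hamiltonian field -/

theorem dotProduct_const_of_sum_eq_zero {n : ℕ} {d : Fin n → ℝ} (hd : ∑ i, d i = 0) (c : ℝ) :
    d ⬝ᵥ (fun _ => c) = 0 := by
  simp [dotProduct, ← Finset.sum_mul, hd]

theorem twoForm_eq {n : ℕ} (A : Matrix (Fin n) (Fin n) ℝ) (V Y : PhaseSpace n) :
    twoForm A V Y = V.1 ⬝ᵥ (A *ᵥ Y.2) - Y.1 ⬝ᵥ (A *ᵥ V.2) := by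
  simp only [twoForm, dotProduct, Matrix.mulVec, Finset.mul_sum, ← Finset.sum_sub_distrib]
  exact Finset.sum_congr rfl fun i _ => Finset.sum_congr rfl fun j _ => by ring

/-- A subgradient of the maximum over the simplex is a maximizer. -/
theorem mem_maxFace_of_subgradient {n : ℕ} [NeZero n] {u x : Fin n → ℝ} (hx : ∑ i, x i = 1)
    (h : ∀ w, simplexMax u + x ⬝ᵥ w ≤ simplexMax (u + w)) : x ∈ maxFace u := by
  have hpos : ∀ i, 0 ≤ x i := fun i => by
    have h1 := h (-Pi.single i 1)
    obtain ⟨y, hy⟩ := maxFace_nonempty (u + -Pi.single i 1)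
    have h2 := dotProduct_le_simplexMax (u := u) hy.1
    rw [simplexMax_eq hy, dotProduct_neg, dotProduct_single_one, dotProduct_add, dotProduct_neg,
      dotProduct_single_one] at h1
    linarith [hy.1.1 i]
  refine mem_maxFace_of_simplexMax_le ⟨hpos, hx⟩ ?_
  have h1 := h (-u)
  obtain ⟨y, hy⟩ := maxFace_nonempty (0 : Fin n → ℝ)
  rw [add_neg_cancel, simplexMax_eq hy, dotProduct_zero, dotProduct_neg] at h1
  linarith

section completelyMixed
variable {n : ℕ} {M : Matrix (Fin n) (Fin n) ℝ} {e : PhaseSpace n}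

namespace IsCompletelyMixed

theorem exists_mulVec_eq (he : IsCompletelyMixed M e) :
    ∃ mu : ℝ, (M *ᵥ e.2 = fun _ => mu) ∧ e.1 ᵥ* M = fun _ => mu := by
  obtain ⟨hmem, -, -, ⟨lam, hlam⟩, mu, hmu⟩ := he
  refine ⟨mu, hmu, ?_⟩
  have h := Matrix.dotProduct_mulVec e.1 M e.2
  rw [hlam, hmu, dotProduct_const_of_mem_stdSimplex hmem.1, dotProduct_comm,
    dotProduct_const_of_mem_stdSimplex hmem.2] at h
  rw [hlam, h]

theorem bestResponse_add_smul (he : IsCompletelyMixed M e) (c : ℝ) (z : PhaseSpace n) :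
    bestResponse M (z + c • e) = bestResponse M z := by
  obtain ⟨mu, h1, h2⟩ := he.exists_mulVec_eq
  have e1 : M *ᵥ (z + c • e).2 = M *ᵥ z.2 + fun _ => c * mu := by
    rw [Prod.snd_add, Prod.smul_snd, Matrix.mulVec_add, Matrix.mulVec_smul, h1]; rfl
  have e2 : -((z + c • e).1 ᵥ* M) = -(z.1 ᵥ* M) + fun _ => -(c * mu) := by
    rw [Prod.fst_add, Prod.smul_fst, Matrix.add_vecMul, Matrix.smul_vecMul, h2, neg_add]; rfl
  rw [bestResponse_eq, bestResponse_eq, e1, e2, maxFace_add_const, maxFace_add_const]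

theorem gameHamiltonian_add_smul [NeZero n] (he : IsCompletelyMixed M e) (c : ℝ)
    (z : PhaseSpace n) : gameHamiltonian M (z + c • e) = gameHamiltonian M z := by
  obtain ⟨mu, h1, h2⟩ := he.exists_mulVec_eq
  have e1 : M *ᵥ (z + c • e).2 = M *ᵥ z.2 + fun _ => c * mu := by
    rw [Prod.snd_add, Prod.smul_snd, Matrix.mulVec_add, Matrix.mulVec_smul, h1]; rfl
  have e2 : -((z + c • e).1 ᵥ* M) = -(z.1 ᵥ* M) + fun _ => -(c * mu) := by
    rw [Prod.fst_add, Prod.smul_fst, Matrix.add_vecMul, Matrix.smul_vecMul, h2, neg_add]; rfl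
  rw [gameHamiltonian_eq, gameHamiltonian_eq, e1, e2, simplexMax_add_const, simplexMax_add_const]
  ring

theorem gameHamiltonian_sub [NeZero n] (he : IsCompletelyMixed M e) (z : PhaseSpace n) :
    gameHamiltonian M (z - e) = gameHamiltonian M z := by
  simpa [sub_eq_add_neg] using he.gameHamiltonian_add_smul (-1) z

theorem gameHamiltonian_pos [NeZero n] (he : IsCompletelyMixed M e)
    (hdet : (bordered M).det ≠ 0) {v : PhaseSpace n} (hv : v ∈ tangentPairs n) (hv0 : v ≠ 0) :
    0 < gameHamiltonian M v := by
  obtain ⟨mu, h1, h2⟩ := he.exists_mulVec_eq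
  -- A vector orthogonal to strictly positive weights has nonnegative maximum, and maximum zero only
  -- if it vanishes.
  have key : ∀ {x d : Fin n → ℝ}, x ∈ stdSimplex ℝ (Fin n) → (∀ i, 0 < x i) → x ⬝ᵥ d = 0 →
      0 ≤ simplexMax d ∧ (simplexMax d ≤ 0 → d = 0) := by
    intro x d hx hpos hxd
    refine ⟨hxd ▸ dotProduct_le_simplexMax hx, fun hle => funext fun i => ?_⟩
    have hd : ∀ j, d j ≤ 0 := fun j => by
      have := (dotProduct_le_simplexMax (u := d) (single_mem_stdSimplex ℝ j)).trans hle
      rwa [single_one_dotProduct] at this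
    have h3 := (Finset.sum_eq_zero_iff_of_nonpos fun j _ =>
      mul_nonpos_of_nonneg_of_nonpos (hpos j).le (hd j)).1 hxd i (Finset.mem_univ i)
    exact (mul_eq_zero.1 h3).resolve_left (hpos i).ne'
  have k1 := key he.1.1 he.2.1 (d := M *ᵥ v.2) (by
    rw [Matrix.dotProduct_mulVec, h2, dotProduct_comm, dotProduct_const_of_sum_eq_zero hv.2])
  have k2 := key he.1.2 he.2.2.1 (d := -(v.1 ᵥ* M)) (by
    rw [dotProduct_neg, dotProduct_comm, ← Matrix.dotProduct_mulVec, h1,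
      dotProduct_const_of_sum_eq_zero hv.1, neg_zero])
  rw [gameHamiltonian_eq]
  by_contra! hle
  refine hv0 (Prod.ext ?_ ?_)
  · have := k2.2 (by linarith [k1.1])
    refine eq_zero_of_mulVec_eq_const (M := Mᵀ) (by rwa [det_bordered_transpose]) hv.1 (c := 0) ?_
    rw [Matrix.mulVec_transpose]
    exact neg_eq_zero.1 this
  · exact eq_zero_of_mulVec_eq_const hdet hv.2 (c := 0) (k1.2 (by linarith [k2.1]))

theorem sub_mem_tangentPairs (he : IsCompletelyMixed M e) {x : PhaseSpace n}
    (hx : x ∈ strategyPairs n) : x - e ∈ tangentPairs n :=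
  ⟨by simp [hx.1.2, he.1.1.2], by simp [hx.2.2, he.1.2.2]⟩

/-- The Hamiltonian vector field consists of the best responses, seen from the equilibrium. -/
theorem mem_hamiltonianField_iff [NeZero n] (he : IsCompletelyMixed M e)
    (hdet : (bordered M).det ≠ 0) {x V : PhaseSpace n} :
    V ∈ hamiltonianField M M x ↔ V + e ∈ bestResponse M x := by
  obtain ⟨mu, h1, h2⟩ := he.exists_mulVec_eq
  -- The equilibrium pairs to zero with tangent vectors, so replacing `V` by `V + e` does not change
  -- the form.
  have t1 : ∀ Y ∈ tangentPairs n, e.1 ⬝ᵥ (M *ᵥ Y.2) = 0 := fun Y hY => by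
    rw [Matrix.dotProduct_mulVec, h2, dotProduct_comm, dotProduct_const_of_sum_eq_zero hY.2]
  have t2 : ∀ Y ∈ tangentPairs n, Y.1 ⬝ᵥ (M *ᵥ e.2) = 0 := fun Y hY => by
    rw [h1, dotProduct_const_of_sum_eq_zero hY.1]
  have hform : ∀ Y ∈ tangentPairs n, twoForm M V Y =
      (V + e).1 ⬝ᵥ (M *ᵥ Y.2) + (V + e).2 ⬝ᵥ (-(Y.1 ᵥ* M)) := fun Y hY => by
    rw [dotProduct_neg, dotProduct_comm (V + e).2, ← Matrix.dotProduct_mulVec, twoForm_eq,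
      Prod.fst_add, Prod.snd_add, add_dotProduct, t1 Y hY, Matrix.mulVec_add, dotProduct_add,
      t2 Y hY]
    ring
  constructor
  · rintro ⟨hV, hsub⟩
    rw [bestResponse_eq]
    constructor
    · have hsum : ∑ i, (V + e).1 i = 1 := by
        simp [Finset.sum_add_distrib, hV.1, he.1.1.2]
      refine mem_maxFace_of_subgradient hsum fun w => ?_
      -- Subgradients are tested only along tangent vectors, but nonsingularity writes every `w` as
      -- `M *ᵥ d` plus a constant, and constants shift both sides equally because `V + e` has
      -- component sum one.
      obtain ⟨d, c, hd, hdc⟩ := exists_mulVec_add_const_eq hdet w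
      have hY : ((0, d) : PhaseSpace n) ∈ tangentPairs n := ⟨by simp, hd⟩
      have h3 := hsub _ hY
      rw [hform _ hY, gameHamiltonian_eq, gameHamiltonian_eq] at h3
      simp only [Matrix.zero_vecMul, neg_zero, dotProduct_zero, add_zero, Prod.snd_add,
        Prod.fst_add, Matrix.mulVec_add] at h3
      rw [← hdc, ← add_assoc, simplexMax_add_const, dotProduct_add]
      have h4 : (V + e).1 ⬝ᵥ (fun _ => c) = c := by
        simp only [dotProduct, ← Finset.sum_mul, hsum, one_mul]
      rw [h4, Prod.fst_add]
      linarith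
    · have hsum : ∑ i, (V + e).2 i = 1 := by
        simp [Finset.sum_add_distrib, hV.2, he.1.2.2]
      refine mem_maxFace_of_subgradient hsum fun w => ?_
      obtain ⟨d, c, hd, hdc⟩ := exists_mulVec_add_const_eq (M := Mᵀ)
        (by rwa [det_bordered_transpose]) w
      have hY : ((-d, 0) : PhaseSpace n) ∈ tangentPairs n := ⟨by simp [hd], by simp⟩
      have h3 := hsub _ hY
      rw [hform _ hY, gameHamiltonian_eq, gameHamiltonian_eq] at h3
      simp only [Matrix.mulVec_zero, dotProduct_zero, zero_add, add_zero, Prod.snd_add,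
        Prod.fst_add, Matrix.add_vecMul, Matrix.neg_vecMul, neg_add, neg_neg] at h3
      rw [Matrix.mulVec_transpose] at hdc
      rw [← hdc, ← add_assoc, simplexMax_add_const, dotProduct_add]
      have h4 : (V + e).2 ⬝ᵥ (fun _ => c) = c := by
        simp only [dotProduct, ← Finset.sum_mul, hsum, one_mul]
      rw [h4, Prod.snd_add]
      linarith
  · intro hV
    have hVT : V ∈ tangentPairs n := by
      simpa using he.sub_mem_tangentPairs (bestResponse_subset M x hV)
    refine ⟨hVT, fun Y hY => ?_⟩
    rw [bestResponse_eq] at hV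
    have h3 := dotProduct_le_simplexMax (u := M *ᵥ (x + Y).2) hV.1.1
    have h4 := dotProduct_le_simplexMax (u := -((x + Y).1 ᵥ* M)) hV.2.1
    rw [hform Y hY, gameHamiltonian_eq, gameHamiltonian_eq, simplexMax_eq hV.1,
      simplexMax_eq hV.2]
    rw [Prod.snd_add, Matrix.mulVec_add, dotProduct_add] at h3
    rw [Prod.fst_add x Y, Matrix.add_vecMul, neg_add, dotProduct_add] at h4
    rw [Prod.snd_add x Y, Matrix.mulVec_add, Prod.fst_add x Y, Matrix.add_vecMul, neg_add]
    linarith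

end IsCompletelyMixed

theorem isSymplecticOnTangent_of_det_ne_zero (hdet : (bordered M).det ≠ 0) :
    IsSymplecticOnTangent M := by
  intro V hV h
  have hdet' : (bordered Mᵀ).det ≠ 0 := by rwa [det_bordered_transpose]
  refine Prod.ext (dotProduct_self_eq_zero.1 ?_) (dotProduct_self_eq_zero.1 ?_)
  · obtain ⟨d, c, hd, hdc⟩ := exists_mulVec_add_const_eq hdet V.1
    have h1 := h (0, d) ⟨by simp, hd⟩
    rw [twoForm_eq] at h1
    simp only [zero_dotProduct, sub_zero] at h1
    nth_rw 2 [← hdc]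
    rw [dotProduct_add, h1, dotProduct_const_of_sum_eq_zero hV.1, add_zero]
  · obtain ⟨d, c, hd, hdc⟩ := exists_mulVec_add_const_eq hdet' V.2
    have h1 := h (d, 0) ⟨hd, by simp⟩
    rw [twoForm_eq, Matrix.dotProduct_mulVec d, dotProduct_comm (d ᵥ* M)] at h1
    simp only [Matrix.mulVec_zero, dotProduct_zero, zero_sub, neg_eq_zero] at h1
    rw [Matrix.mulVec_transpose] at hdc
    nth_rw 2 [← hdc]
    rw [dotProduct_add, h1, dotProduct_const_of_sum_eq_zero hV.2, add_zero]

theorem isNashEquilibrium_iff_isSaddle {x : PhaseSpace n} :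
    IsNashEquilibrium M x ↔ IsSaddle M 0 x := by
  rw [IsSaddle, bestResponse_zero]
  constructor
  · exact fun h => ⟨⟨h.1.1, h.2.1⟩, fun w hw => (h.1.2 w.1 hw.1).trans (h.2.2 w.2 hw.2)⟩
  · exact fun h => ⟨⟨h.1.1, fun y hy => h.2 (y, x.2) ⟨hy, h.1.2⟩⟩,
      h.1.2, fun y hy => h.2 (x.1, y) ⟨h.1.1, hy⟩⟩

theorem IsCompletelyMixed.isNashEquilibrium_iff (he : IsCompletelyMixed M e)
    (hM : HasUniqueSaddles M) {x : PhaseSpace n} : IsNashEquilibrium M x ↔ x = e := by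
  have hs : IsSaddle M 0 e := by
    obtain ⟨mu, h1, h2⟩ := he.exists_mulVec_eq
    rw [IsSaddle, bestResponse_zero]
    refine ⟨he.1, fun w hw => ?_⟩
    rw [h1, dotProduct_const_of_mem_stdSimplex hw.1, Matrix.dotProduct_mulVec, h2,
      dotProduct_comm, dotProduct_const_of_mem_stdSimplex hw.2]
  rw [isNashEquilibrium_iff_isSaddle]
  exact ⟨fun h => hM _ _ _ h hs, fun h => h ▸ hs⟩

end completelyMixed

/-! ### The best response flow and the Hamiltonian flow -/

theorem lipschitzWith_smul_const {E : Type*} [NormedAddCommGroup E] [NormedSpace ℝ E] (e : E) :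
    LipschitzWith ‖e‖₊ fun r : ℝ => r • e :=
  LipschitzWith.of_dist_le_mul fun r s => by
    rw [dist_eq_norm, ← sub_smul, norm_smul, mul_comm, coe_nnnorm, dist_eq_norm]

theorem absolutelyContinuousOnInterval_smul_const {E : Type*} [NormedAddCommGroup E]
    [NormedSpace ℝ E] (e : E) (a b : ℝ) :
    AbsolutelyContinuousOnInterval (fun r : ℝ => r • e) a b :=
  (lipschitzWith_smul_const e).lipschitzOnWith.absolutelyContinuousOnInterval

theorem exp_neg_smul_mem_strategyPairs {n : ℕ} {M : Matrix (Fin n) (Fin n) ℝ}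
    {Φ : ℝ → PhaseSpace n → PhaseSpace n} (hΦ : IsGameFlow M Φ) {t : ℝ} (ht : 0 ≤ t)
    {x : PhaseSpace n} (hx : x ∈ strategyPairs n) :
    Real.exp (-t) • Φ (Real.exp t - 1) x ∈ strategyPairs n := by
  have hτ : 0 ≤ Real.exp t - 1 := sub_nonneg.2 (Real.one_le_exp ht)
  obtain ⟨v, hv, h⟩ := hΦ.exists_strategyPairs hτ x
  have hconv : Convex ℝ (strategyPairs n) :=
    (convex_stdSimplex ℝ (Fin n)).prod (convex_stdSimplex ℝ (Fin n))
  have h1 : Real.exp (-t) * Real.exp t = 1 := by rw [← Real.exp_add, neg_add_cancel, Real.exp_zero]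
  rw [h, smul_add, smul_smul]
  -- The point is a convex combination of `x` and `v` with weights e⁻ᵗ and 1 - e⁻ᵗ.
  exact hconv hx hv (Real.exp_pos _).le (mul_nonneg (Real.exp_pos _).le hτ) (by linarith)

section flows
variable {n : ℕ} [NeZero n] {M : Matrix (Fin n) (Fin n) ℝ} {e : PhaseSpace n}
  {Φ : ℝ → PhaseSpace n → PhaseSpace n}

/-- Solutions of the best response dynamics are rescaled orbits of the game flow. -/
theorem IsGameFlow.eq_of_bestResponseField (hΦ : IsGameFlow M Φ) {γ : ℝ → PhaseSpace n} {b : ℝ}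
    (hγ : IsInclusionSolution (bestResponseField M) 0 b γ) {t : ℝ} (ht : t ∈ Icc 0 b) :
    γ t = Real.exp (-t) • Φ (Real.exp t - 1) (γ 0) := by
  -- The factor eʳ absorbs the term -γ: the derivative of `Z` is eʳ times a best response, and the
  -- new clock τ = eʳ - 1 removes eʳ.
  set Z : ℝ → PhaseSpace n := fun r => Real.exp r • γ r with hZ
  have hexp : AbsolutelyContinuousOnInterval Real.exp 0 b :=
    Real.contDiff_exp.contDiffOn.absolutelyContinuousOnInterval
  have hZac : AbsolutelyContinuousOnInterval Z 0 b := hexp.smul hγ.1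
  have hbr : ∀ r, bestResponse M (Z r) = bestResponse M (γ r) := fun r =>
    bestResponse_smul M _ (Real.exp_pos r)
  have hae : ∀ᵐ r ∂(volume.restrict (Icc 0 b)), ∃ v ∈ bestResponse M (Z r),
      HasDerivAt Z (Real.exp r • v) r := by
    filter_upwards [hγ.2] with r hr
    obtain ⟨v, hv, hd⟩ := hr
    refine ⟨v + γ r, by rw [hbr]; exact hv, ?_⟩
    have := (Real.hasDerivAt_exp r).smul hd
    rwa [← smul_add] at this
  have hlog : ∀ τ ∈ Icc 0 (Real.exp b - 1), Real.log (1 + τ) ∈ Icc 0 b := fun τ hτ =>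
    ⟨Real.log_nonneg (by linarith [hτ.1]),
      (Real.log_le_iff_le_exp (by linarith [hτ.1])).2 (by linarith [hτ.2])⟩
  have hw : IsWeakSolution M (Icc 0 (Real.exp b - 1)) fun τ => Z (Real.log (1 + τ)) := by
    intro σ hσ τ hτ hστ
    refine ⟨gameHamiltonian_eq_of_ae_mem_bestResponse hZac hae (hlog σ hσ) (hlog τ hτ),
      fun w hw => ?_⟩
    rcases hστ.eq_or_lt with rfl | hlt
    · obtain ⟨v, hv⟩ := bestResponse_nonempty M (Z (Real.log (1 + σ)))
      exact ⟨v, hw σ ⟨le_rfl, le_rfl⟩ hv, by simp⟩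
    have hσ0 : 0 < 1 + σ := by linarith [hσ.1]
    have hτ0 : 0 < 1 + τ := by linarith [hτ.1]
    obtain ⟨v, hv, h⟩ := exists_mem_bestResponse_of_ae hZac Real.hasDerivAt_exp Real.exp_pos hexp
      hae (hlog σ hσ) (hlog τ hτ) (Real.log_lt_log hσ0 (by linarith)) (w := w) fun r hr => by
        have h1 : 1 + σ ≤ Real.exp r := (Real.log_le_iff_le_exp hσ0).1 hr.1
        have h2 : Real.exp r ≤ 1 + τ := (Real.le_log_iff_exp_le hτ0).1 hr.2
        simpa using hw (Real.exp r - 1) ⟨by linarith, by linarith⟩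
    refine ⟨v, hv, ?_⟩
    rw [h, Real.exp_log hσ0, Real.exp_log hτ0, add_sub_add_left_eq_sub]
  have hb : 0 ≤ Real.exp b - 1 := sub_nonneg.2 (Real.one_le_exp (ht.1.trans ht.2))
  have := hΦ.eq_of_weak _ 0 _ le_rfl hb hw (Real.exp t - 1)
    ⟨sub_nonneg.2 (Real.one_le_exp ht.1), by gcongr; exact ht.2⟩
  simp only [add_sub_cancel, Real.log_exp, add_zero, Real.log_one, hZ, Real.exp_zero,
    one_smul] at this
  rw [← this, smul_smul, ← Real.exp_add, neg_add_cancel, Real.exp_zero, one_smul]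

/-- Solutions of the Hamiltonian inclusion are orbits of the game flow, seen from the
equilibrium. -/
theorem IsGameFlow.eq_of_hamiltonianField (hΦ : IsGameFlow M Φ) (he : IsCompletelyMixed M e)
    (hdet : (bordered M).det ≠ 0) {γ : ℝ → PhaseSpace n} {a b : ℝ} (ha : a ≤ 0) (hb : 0 ≤ b)
    (hγ : IsInclusionSolution (hamiltonianField M M) a b γ) {t : ℝ} (ht : t ∈ Icc a b) :
    γ t = Φ t (γ 0) - t • e := by
  set Z : ℝ → PhaseSpace n := fun r => γ r + r • e with hZ
  have hid : AbsolutelyContinuousOnInterval (fun r : ℝ => r) a b :=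
    contDiff_id.contDiffOn.absolutelyContinuousOnInterval
  have hZac : AbsolutelyContinuousOnInterval Z a b := by
    refine hγ.1.fun_add ?_
    exact absolutelyContinuousOnInterval_smul_const e a b
  have hae : ∀ᵐ r ∂(volume.restrict (Icc a b)), ∃ v ∈ bestResponse M (Z r),
      HasDerivAt Z ((1 : ℝ) • v) r := by
    filter_upwards [hγ.2] with r hr
    obtain ⟨v, hv, hd⟩ := hr
    refine ⟨v + e, ?_, ?_⟩
    · rw [hZ, he.bestResponse_add_smul]
      exact (he.mem_hamiltonianField_iff hdet).1 hv
    · have h := hd.fun_add ((hasDerivAt_id' r).smul_const e)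
      rw [one_smul] at h ⊢
      exact h
  have hw : IsWeakSolution M (Icc a b) Z := by
    intro s hs r hr hsr
    refine ⟨gameHamiltonian_eq_of_ae_mem_bestResponse (C' := fun _ => 1) hZac hae hs hr,
      fun w hw => ?_⟩
    rcases hsr.eq_or_lt with rfl | hlt
    · obtain ⟨v, hv⟩ := bestResponse_nonempty M (Z s)
      exact ⟨v, hw s ⟨le_rfl, le_rfl⟩ hv, by simp⟩
    exact exists_mem_bestResponse_of_ae (C := fun r => r) (C' := fun _ => 1) hZac
      hasDerivAt_id' (fun _ => one_pos) hid hae hs hr hlt hw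
  have := hΦ.eq_of_weak Z a b ha hb hw t ht
  simp only [hZ, zero_smul, add_zero] at this
  rw [← this, add_sub_cancel_right]

theorem isInclusionFlow_bestResponseField (hΦ : IsGameFlow M Φ) (hM : HasUniqueSaddles M) :
    IsInclusionFlow (bestResponseField M) (strategyPairs n) (Ici 0)
      fun t x => Real.exp (-t) • Φ (Real.exp t - 1) x where
  mapsTo t ht x hx := exp_neg_smul_mem_strategyPairs hΦ ht hx
  map_zero x _ := by simp [hΦ.zero]
  map_add s _ t _ x _ := by
    -- Splitting the clock this way lets the scaling symmetry with factor eᵗ reduce the remaining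
    -- time to eˢ - 1.
    have h1 : Real.exp (s + t) - 1 = Real.exp t * (Real.exp s - 1) + (Real.exp t - 1) := by
      rw [Real.exp_add]; ring
    have h2 : Φ (Real.exp t - 1) x =
        Real.exp t • (Real.exp (-t) • Φ (Real.exp t - 1) x) := by
      rw [smul_smul, ← Real.exp_add, add_neg_cancel, Real.exp_zero, one_smul]
    rw [h1, hΦ.map_add, h2, hΦ.map_smul (Real.exp_pos t), ← h2, smul_smul, ← Real.exp_add]
    congr 2
    ring
  solution x _ a ha b _ hab := by
    have hsub : ∀ c : ℝ, AbsolutelyContinuousOnInterval (fun t => Real.exp (c * t)) a b := fun c =>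
      ContDiffOn.absolutelyContinuousOnInterval (ContDiff.contDiffOn (by fun_prop))
    have hsub' : AbsolutelyContinuousOnInterval (fun t => Real.exp t - 1) a b :=
      ContDiffOn.absolutelyContinuousOnInterval (ContDiff.contDiffOn (by fun_prop))
    refine isInclusionSolution_of_hasDerivWithinAt_Ici ?_ fun t ht => ?_
    · simpa using! (hsub (-1)).smul (hsub'.lipschitzWith_comp (hΦ.lipschitzWith x))
    · obtain ⟨v, hv, hd⟩ := (hΦ.weak x).exists_hasDerivWithinAt_Ici hM (Real.exp t - 1)
      refine ⟨v - Real.exp (-t) • Φ (Real.exp t - 1) x, ?_, ?_⟩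
      · have hv' : v ∈ bestResponse M (Real.exp (-t) • Φ (Real.exp t - 1) x) := by
          rwa [bestResponse_smul M _ (Real.exp_pos _)]
        have : v - Real.exp (-t) • Φ (Real.exp t - 1) x + Real.exp (-t) • Φ (Real.exp t - 1) x ∈
            bestResponse M (Real.exp (-t) • Φ (Real.exp t - 1) x) := by rwa [sub_add_cancel]
        exact this
      · have h1 : HasDerivWithinAt (fun r => Real.exp r - 1) (Real.exp t) (Ici t) t :=
          ((Real.hasDerivAt_exp t).sub_const 1).hasDerivWithinAt
        have h2 := hd.scomp t h1 fun r hr => sub_le_sub_right (Real.exp_le_exp.2 hr) 1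
        have h3 : HasDerivWithinAt (fun r => Real.exp (-r)) (-Real.exp (-t)) (Ici t) t := by
          simpa using ((hasDerivAt_neg t).exp).hasDerivWithinAt
        have h4 := h3.smul h2
        rw [smul_smul, ← Real.exp_add, neg_add_cancel, Real.exp_zero, one_smul, neg_smul,
          ← sub_eq_add_neg] at h4
        exact h4
  unique x _ a ha b _ ha0 _ γ hγ hγ0 t ht := by
    obtain rfl : a = 0 := le_antisymm ha0 ha
    rw [hΦ.eq_of_bestResponseField hγ ht, hγ0]

theorem isInclusionFlow_hamiltonianField (hΦ : IsGameFlow M Φ) (hM : HasUniqueSaddles M)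
    (he : IsCompletelyMixed M e) (hdet : (bordered M).det ≠ 0) {ρ : ℝ}
    (hρ : ∀ v ∈ tangentPairs n, gameHamiltonian M v = ρ → e + v ∈ strategyPairs n) :
    IsInclusionFlow (hamiltonianField M M) (hamiltonianLevel M ρ) univ
      fun s y => Φ s y - s • e where
  mapsTo s _ y hy := by
    have hH : gameHamiltonian M (Φ s y - s • e) = ρ := by
      rw [sub_eq_add_neg, ← neg_smul, he.gameHamiltonian_add_smul, hΦ.gameHamiltonian_eq, hy.2]
    refine ⟨?_, hH⟩
    -- Component sums grow at unit rate along `Φ`, which `s • e` compensates; for negative `s` the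
    -- flow is run forward from `Φ s y` to `y`.
    have hsum : Φ s y - s • e - e ∈ tangentPairs n := by
      have key : ∀ {s : ℝ} {y z : PhaseSpace n}, 0 ≤ s → Φ s y = z →
          ∑ i, z.1 i = ∑ i, y.1 i + s ∧ ∑ i, z.2 i = ∑ i, y.2 i + s := by
        intro s y z hs hz
        obtain ⟨v, hv, h⟩ := hΦ.exists_strategyPairs hs y
        rw [← hz, h]
        simp [Finset.sum_add_distrib, ← Finset.mul_sum, hv.1.2, hv.2.2]
      have h2 : ∑ i, (Φ s y).1 i = 1 + s ∧ ∑ i, (Φ s y).2 i = 1 + s := by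
        rcases le_total 0 s with hs | hs
        · have := key hs rfl (y := y)
          rwa [hy.1.1.2, hy.1.2.2] at this
        · have := key (s := -s) (y := Φ s y) (z := y) (by linarith) (by
            rw [← hΦ.map_add, neg_add_cancel, hΦ.zero])
          rw [hy.1.1.2, hy.1.2.2] at this
          constructor <;> linarith [this.1, this.2]
      constructor
      · simp [← Finset.mul_sum, h2.1, he.1.1.2]
      · simp [← Finset.mul_sum, h2.2, he.1.2.2]
    simpa using hρ _ hsum ((he.gameHamiltonian_sub _).trans hH)
  map_zero y _ := by simp [hΦ.zero]
  map_add s _ t _ y _ := by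
    have h := hΦ.map_add_const (e := -(t • e)) (a := 0)
      (fun z => by rw [← neg_smul, he.bestResponse_add_smul])
      (fun z => by rw [← neg_smul, he.gameHamiltonian_add_smul, add_zero]) s (Φ t y)
    rw [hΦ.map_add, sub_eq_add_neg (Φ t y), h, add_smul]
    abel
  solution y _ a _ b _ hab := by
    refine isInclusionSolution_of_hasDerivWithinAt_Ici ?_ fun t ht => ?_
    · exact (hΦ.lipschitzWith y).lipschitzOnWith.absolutelyContinuousOnInterval.fun_sub
        (absolutelyContinuousOnInterval_smul_const e a b)
    · obtain ⟨v, hv, hd⟩ := (hΦ.weak y).exists_hasDerivWithinAt_Ici hM t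
      refine ⟨v - e, ?_, ?_⟩
      · rw [he.mem_hamiltonianField_iff hdet, sub_add_cancel, sub_eq_add_neg, ← neg_smul,
          he.bestResponse_add_smul]
        exact hv
      · have h := hd.fun_sub ((hasDerivAt_id' t).smul_const e).hasDerivWithinAt
        rw [one_smul] at h
        exact h
  unique y _ a _ b _ ha hb γ hγ hγ0 t ht := by
    rw [hΦ.eq_of_hamiltonianField he hdet ha hb hγ ht, hγ0]

end flows

/-! ### Level sets of the Hamiltonian and rays from the equilibrium -/

section projection
variable {n : ℕ} [NeZero n] {M : Matrix (Fin n) (Fin n) ℝ} {e : PhaseSpace n}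

theorem isClosed_tangentPairs (n : ℕ) : IsClosed (tangentPairs n) := by
  simp only [tangentPairs]
  exact (isClosed_eq (by fun_prop) continuous_const).inter
    (isClosed_eq (by fun_prop) continuous_const)

theorem smul_mem_tangentPairs {n : ℕ} {v : PhaseSpace n} (hv : v ∈ tangentPairs n) (c : ℝ) :
    c • v ∈ tangentPairs n :=
  ⟨by simp [← Finset.mul_sum, hv.1], by simp [← Finset.mul_sum, hv.2]⟩

/-- Small sublevel sets of the Hamiltonian lie in the product of the simplices. -/
theorem IsCompletelyMixed.exists_pos_forall_mem_strategyPairs (he : IsCompletelyMixed M e)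
    (hdet : (bordered M).det ≠ 0) :
    ∃ ρ₀ > 0, ∀ v ∈ tangentPairs n, gameHamiltonian M v < ρ₀ → e + v ∈ strategyPairs n := by
  obtain ⟨ε, hε, hball⟩ : ∃ ε > 0, ∀ v ∈ tangentPairs n, ‖v‖ ≤ ε → e + v ∈ strategyPairs n := by
    have hev : ∀ᶠ v : PhaseSpace n in nhds 0, (∀ i, 0 < e.1 i + v.1 i) ∧ ∀ i, 0 < e.2 i + v.2 i := by
      refine (Filter.eventually_all.2 fun i => ?_).and (Filter.eventually_all.2 fun i => ?_)
      · have hc : Continuous fun v : PhaseSpace n => e.1 i + v.1 i := by fun_prop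
        exact hc.continuousAt.eventually (lt_mem_nhds (by simpa using he.2.1 i))
      · have hc : Continuous fun v : PhaseSpace n => e.2 i + v.2 i := by fun_prop
        exact hc.continuousAt.eventually (lt_mem_nhds (by simpa using he.2.2.1 i))
    obtain ⟨ε, hε, h⟩ := Metric.eventually_nhds_iff.1 hev
    refine ⟨ε / 2, by positivity, fun v hv hvε => ?_⟩
    have h1 := h (y := v) (by rw [dist_zero_right]; linarith)
    exact ⟨⟨fun i => (h1.1 i).le, by simp [Finset.sum_add_distrib, he.1.1.2, hv.1]⟩,
      fun i => (h1.2 i).le, by simp [Finset.sum_add_distrib, he.1.2.2, hv.2]⟩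
  obtain ⟨m, hm, hmin⟩ : ∃ m > 0, ∀ v ∈ tangentPairs n, ‖v‖ = ε → m ≤ gameHamiltonian M v := by
    -- The sphere has no tangent vectors when n = 1; then any positive bound serves.
    rcases (Metric.sphere (0 : PhaseSpace n) ε ∩ tangentPairs n).eq_empty_or_nonempty with h0 | h0
    · exact ⟨1, one_pos, fun v hv hvε => absurd (h0.subset
        (show v ∈ Metric.sphere 0 ε ∩ tangentPairs n from
          ⟨mem_sphere_zero_iff_norm.2 hvε, hv⟩)) (notMem_empty v)⟩
    · obtain ⟨w, hw, hwmin⟩ := ((isCompact_sphere _ _).inter_right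
        (isClosed_tangentPairs n)).exists_isMinOn h0 (continuous_gameHamiltonian M).continuousOn
      refine ⟨_, he.gameHamiltonian_pos hdet hw.2 ?_, fun v hv hvε =>
        hwmin ⟨mem_sphere_zero_iff_norm.2 hvε, hv⟩⟩
      rintro rfl
      exact hε.ne (by simpa using hw.1)
  refine ⟨m, hm, fun v hv hvm => hball v hv ?_⟩
  by_contra! hlt
  -- Rescaling a longer `v` to the sphere and using homogeneity would give H(v) at least m ‖v‖ / ε,
  -- more than `m`.
  have hv0 : 0 < ‖v‖ := hε.trans hlt
  have h1 := hmin ((ε / ‖v‖) • v) (smul_mem_tangentPairs hv _) (by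
    rw [norm_smul, Real.norm_eq_abs, abs_of_pos (by positivity), div_mul_cancel₀ _ hv0.ne'])
  rw [gameHamiltonian_smul M v (by positivity), div_mul_eq_mul_div, le_div_iff₀ hv0] at h1
  have h2 : 0 < gameHamiltonian M v := he.gameHamiltonian_pos hdet hv (norm_pos_iff.1 hv0)
  have h3 : ε * gameHamiltonian M v < ‖v‖ * m := mul_lt_mul hlt hvm.le h2 hv0.le
  linarith

theorem IsCompletelyMixed.mem_halfRay_inter_hamiltonianLevel_iff (he : IsCompletelyMixed M e)
    (hdet : (bordered M).det ≠ 0) {ρ : ℝ} (hρ : 0 < ρ)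
    (hsub : ∀ v ∈ tangentPairs n, gameHamiltonian M v = ρ → e + v ∈ strategyPairs n)
    {v : PhaseSpace n} (hv : v ∈ tangentPairs n) (hv0 : v ≠ 0) {y : PhaseSpace n} :
    y ∈ halfRay e v ∩ hamiltonianLevel M ρ ↔ y = e + (ρ / gameHamiltonian M v) • v := by
  have hpos := he.gameHamiltonian_pos hdet hv hv0
  have hH : ∀ s : ℝ, 0 ≤ s → gameHamiltonian M (e + s • v) = s * gameHamiltonian M v := by
    intro s hs
    rw [← he.gameHamiltonian_sub, add_sub_cancel_left, gameHamiltonian_smul M v hs]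
  constructor
  · rintro ⟨⟨s, hs, rfl⟩, -, h⟩
    rw [hH s hs] at h
    rw [← h, mul_div_cancel_right₀ _ hpos.ne']
  · rintro rfl
    have hs : 0 ≤ ρ / gameHamiltonian M v := by positivity
    refine ⟨⟨_, hs, rfl⟩, hsub _ (smul_mem_tangentPairs hv _) ?_, ?_⟩
    · rw [gameHamiltonian_smul M v hs, div_mul_cancel₀ _ hpos.ne']
    · rw [hH _ hs, div_mul_cancel₀ _ hpos.ne']

end projection

/-! ### Assembly of the theorem -/

theorem mainTheorem2 (n : ℕ) :
    ∃ W : Set (Matrix (Fin n) (Fin n) ℝ),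
      W ⊆ completelyMixedMatrices n ∧
      IsOpen W ∧
      completelyMixedMatrices n ⊆ closure W ∧
      volume {B : Fin n → Fin n → ℝ | Matrix.of B ∈ completelyMixedMatrices n \ W} = 0 ∧
      ∀ M ∈ W, ∃ e : PhaseSpace n,
        IsCompletelyMixed M e ∧
        -- `e = (p̄, q̄)` is the unique Nash equilibrium
        (∀ x : PhaseSpace n, IsNashEquilibrium M x ↔ x = e) ∧
        IsSymplecticOnTangent M ∧
        ∃ φ : ℝ → PhaseSpace n → PhaseSpace n,
          -- the best response dynamics has a unique flow, which is continuous off `e`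
          IsInclusionFlow (bestResponseField M) (strategyPairs n) (Ici 0) φ ∧
          (∀ t ≥ 0, ∀ x ∈ strategyPairs n \ {e}, φ t x ≠ e) ∧
          ContinuousOn (fun z : ℝ × PhaseSpace n => φ z.1 z.2)
            (Ici 0 ×ˢ (strategyPairs n \ {e})) ∧
          -- for small `ρ > 0` it projects radially to the Hamiltonian flow on `H⁻¹(ρ)`
          ∃ ρ₀ > 0, ∀ ρ : ℝ, 0 < ρ → ρ < ρ₀ →
            (∀ v ∈ tangentPairs n, v ≠ 0 → ∃! y, y ∈ halfRay e v ∩ hamiltonianLevel M ρ) ∧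
            ∃ proj : PhaseSpace n → PhaseSpace n,
              (∀ x ∈ strategyPairs n \ {e},
                proj x ∈ halfRay e (x - e) ∩ hamiltonianLevel M ρ) ∧
              ContinuousOn proj (strategyPairs n \ {e}) ∧
              ∃ ψ : ℝ → PhaseSpace n → PhaseSpace n,
                IsInclusionFlow (hamiltonianField M M) (hamiltonianLevel M ρ) univ ψ ∧
                ContinuousOn (fun z : ℝ × PhaseSpace n => ψ z.1 z.2)
                  (univ ×ˢ hamiltonianLevel M ρ) ∧
                ∀ t ≥ 0, ∀ x ∈ strategyPairs n \ {e},
                  proj (φ t x) =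
                    ψ (ρ / gameHamiltonian M x * (Real.exp t - 1)) (proj x) := by
  refine ⟨completelyMixedMatrices n ∩ {M | IsGenericMatrix M}, inter_subset_left,
    (isOpen_completelyMixedMatrices n).inter (isOpen_setOf_isGenericMatrix n),
    (dense_setOf_isGenericMatrix n).open_subset_closure_inter (isOpen_completelyMixedMatrices n),
    ?_, ?_⟩
  · refine measure_mono_null (fun B hB => ?_) (ae_iff.1 (ae_isGenericMatrix n))
    exact fun hgen => hB.2 ⟨hB.1, hgen⟩
  rintro M ⟨hLI, hgen⟩
  have hn : n ≠ 0 := by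
    rintro rfl
    obtain ⟨x, hx, -⟩ := hLI
    simpa using hx.1.1.2
  have : NeZero n := ⟨hn⟩
  have hdet := det_bordered_ne_zero_of_existsUnique hLI
  obtain ⟨e, he, -⟩ := hLI
  replace he : IsCompletelyMixed M e := he
  have hbd := hgen.supportBound
  have hbd' := hgen.transpose.supportBound
  have hM : HasUniqueSaddles M := hbd.hasUniqueSaddles hbd'
  have hM' : HasUniqueSaddles (-M) :=
    hbd.neg.hasUniqueSaddles (by rw [Matrix.transpose_neg]; exact hbd'.neg)
  obtain ⟨Φ, hΦ⟩ := exists_isGameFlow hM hM'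
  have hΦc := hΦ.continuous hM hM'
  have hne : ∀ {x : PhaseSpace n}, x ∈ strategyPairs n \ {e} →
      x - e ∈ tangentPairs n ∧ x - e ≠ 0 := fun hx =>
    ⟨he.sub_mem_tangentPairs hx.1, sub_ne_zero.2 hx.2⟩
  have hpos : ∀ {x : PhaseSpace n}, x ∈ strategyPairs n \ {e} → 0 < gameHamiltonian M x :=
    fun {x} hx => by
      rw [← he.gameHamiltonian_sub]
      exact he.gameHamiltonian_pos hdet (hne hx).1 (hne hx).2
  have hHe : gameHamiltonian M e = 0 := by
    rw [← he.gameHamiltonian_sub, sub_self, ← zero_smul ℝ (0 : PhaseSpace n),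
      gameHamiltonian_smul M _ le_rfl, zero_mul]
  have hHφ : ∀ t x, gameHamiltonian M (Real.exp (-t) • Φ (Real.exp t - 1) x) =
      Real.exp (-t) * gameHamiltonian M x := fun t x => by
    rw [gameHamiltonian_smul M _ (Real.exp_pos _).le, hΦ.gameHamiltonian_eq]
  have hφe : ∀ t ≥ 0, ∀ x ∈ strategyPairs n \ {e},
      Real.exp (-t) • Φ (Real.exp t - 1) x ≠ e := fun t _ x hx h => by
    have h1 := hHφ t x
    rw [h, hHe] at h1
    exact (mul_pos (Real.exp_pos (-t)) (hpos hx)).ne h1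
  refine ⟨e, he, fun x => he.isNashEquilibrium_iff hM, isSymplecticOnTangent_of_det_ne_zero hdet,
    fun t x => Real.exp (-t) • Φ (Real.exp t - 1) x, isInclusionFlow_bestResponseField hΦ hM, hφe,
    ?_, ?_⟩
  · have : Continuous fun z : ℝ × PhaseSpace n =>
        Real.exp (-z.1) • Φ (Real.exp z.1 - 1) z.2 :=
      (Real.continuous_exp.comp continuous_fst.neg).smul (hΦc.comp
        (((Real.continuous_exp.comp continuous_fst).sub continuous_const).prodMk continuous_snd))
    exact this.continuousOn
  obtain ⟨ρ₀, hρ₀, hsmall⟩ := he.exists_pos_forall_mem_strategyPairs hdet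
  refine ⟨ρ₀, hρ₀, fun ρ hρ hρlt => ?_⟩
  have hsub : ∀ v ∈ tangentPairs n, gameHamiltonian M v = ρ → e + v ∈ strategyPairs n :=
    fun v hv h => hsmall v hv (h ▸ hρlt)
  have hray : ∀ v ∈ tangentPairs n, v ≠ 0 → ∀ y, y ∈ halfRay e v ∩ hamiltonianLevel M ρ ↔
      y = e + (ρ / gameHamiltonian M v) • v := fun v hv hv0 y =>
    he.mem_halfRay_inter_hamiltonianLevel_iff hdet hρ hsub hv hv0
  refine ⟨fun v hv hv0 => ⟨_, (hray v hv hv0 _).2 rfl, fun y hy => (hray v hv hv0 y).1 hy⟩,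
    fun x => e + (ρ / gameHamiltonian M x) • (x - e), fun x hx => ?_, ?_,
    fun s y => Φ s y - s • e, isInclusionFlow_hamiltonianField hΦ hM he hdet hsub, ?_, ?_⟩
  · rw [hray _ (hne hx).1 (hne hx).2, he.gameHamiltonian_sub]
  · refine continuousOn_const.add (ContinuousOn.fun_smul ?_
      (continuous_id.sub continuous_const).continuousOn)
    exact continuousOn_const.div (continuous_gameHamiltonian M).continuousOn
      fun x hx => (hpos hx).ne'
  · exact (hΦc.sub (continuous_fst.smul continuous_const)).continuousOn
  · intro t ht x hx
    have hH0 := hpos hx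
    set k := ρ / gameHamiltonian M x with hk
    have hk0 : 0 < k := by positivity
    -- Radial projection is a scaling followed by a translation along `e`, and both commute with `Φ`
    -- up to the time factor `k`.
    have h1 : e + k • (x - e) = k • x + (1 - k) • e := by
      rw [smul_sub, sub_smul, one_smul]; abel
    have h2 : Φ (k * (Real.exp t - 1)) (k • x + (1 - k) • e) =
        k • Φ (Real.exp t - 1) x + (1 - k) • e := by
      rw [hΦ.map_add_const (a := 0) (he.bestResponse_add_smul _)
        (fun z => by rw [he.gameHamiltonian_add_smul, add_zero]), hΦ.map_smul hk0]
    -- Since H has decayed by e⁻ᵗ, the projection factor at time `t` is k eᵗ, which cancels the e⁻ᵗ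
    -- in the best response flow.
    have h3 : ρ / (Real.exp (-t) * gameHamiltonian M x) = k * Real.exp t := by
      rw [hk, Real.exp_neg]
      field_simp
    beta_reduce
    rw [hHφ, h3, h1, h2, smul_sub, smul_smul, mul_assoc, ← Real.exp_add, add_neg_cancel,
      Real.exp_zero, mul_one, sub_smul, mul_sub, sub_smul, one_smul, mul_one]
    abel
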